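/- **Lemma 1.2 (Definition of $W$).** Let $d\in\{1,2,3\}$ and let $\Lambda$ be either $\mathbb R^d$ or the torus $\mathbb T^d=\mathbb R^d/\mathbb Z^d$, with Lebesgue measure $\mathrm dx$. Let $\kappa>0$, let $v:\Lambda\to[0,\infty)$ be measurable, and let $h=-\Delta+\kappa+v$, the positive operator on $L^2(\Lambda;\mathbb C)$ associated with the quadratic form $f\mapsto\int_\Lambda(|\nabla f|^2+(\kappa+v)|f|^2)\,\mathrm dx$ on $\{f\in H^1(\Lambda): v|f|^2\in L^1(\Lambda)\}$. Suppose that $h=\sum_{k\in\mathbb N}\lambda_k u_ku_k^*$, where $(u_k)_{k\in\mathbb N}$ is an orthonormal basis of $L^2(\Lambda;\mathbb C)$ consisting of eigenfunctions of $h$, with eigenvalues $\lambda_k$ (in any enumeration), and that $$\operatorname{tr}h^{s-1}=\sum_{k\in\mathbb N}\lambda_k^{s-1}<\infty\qquad\text{for some } s\ge -1 .$$ Let $\mu=\bigotimes_{k\in\mathbb N}\mu_k$ on $\mathbb C^{\mathbb N}$, with $\mu_k(\mathrm dz)=\pi^{-1}\mathrm e^{-|z|^2}\mathrm dz$, be the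 law of a sequence $\omega=(\omega_k)_{k\in\mathbb N}$ of independent standard complex Gaussians. For $K\in\mathbb N$ define $$\phi_{[K]}=\sum_{k=0}^K\frac{\omega_k}{\sqrt{\lambda_k}}\,u_k,\qquad \varrho_{[K]}(x)=\int|\phi_{[K]}(x)|^2\,\mathrm d\mu .$$ Let $w\in L^\infty(\Lambda;\mathbb R)$ be even and of positive type, meaning that its Fourier transform (in the sense of tempered distributions if $\Lambda=\mathbb R^d$; the function of Fourier coefficients on $\mathbb Z^d$ if $\Lambda=\mathbb T^d$) is a positive measure, and define the truncated Wick-ordered interaction $$W_{[K]}=\frac12\int_{\Lambda\times\Lambda}\big(|\phi_{[K]}(x)|^2-\varrho_{[K]}(x)\big)\,w(x-y)\,\big(|\phi_{[K]}(y)|^2-\varrho_{[K]}(y)\big)\,\mathrm dx\,\mathrm dy .$$ Then $(W_{[K]})_{K\in\mathbb N}$ is a Cauchy sequence in $\bigcap_{1\le m<\infty}L^m(\mu)$, i.e. every $W_{[K]}$ lies in $L^m(\mu)$ and the sequence is Cauchy in $L^m(\mu)$, for every $1\le m<\infty$. Consequently there is a random variable $W\in\bigcap_{1\le m<\infty}L^m(\mu)$,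 unique up to $\mu$-almost sure equality, such that $W_{[K]}\to W$ in $L^m(\mu)$ for every $1\le m<\infty$; this $W$ is the Wick-ordered (renormalized) classical interaction. -/

import Mathlib

open MeasureTheory Filter Topology
open scoped ENNReal InnerProductSpace SchwartzMap FourierTransform ComplexOrder

noncomputable section

namespace WickInteraction

/-- The Euclidean space `ℝ^d`. -/
abbrev Eucl (d : ℕ) : Type := EuclideanSpace ℝ (Fin d)

/-- The torus `ℝ^d / ℤ^d`, with its Haar (Lebesgue) measure of total mass one. -/
abbrev Torus (d : ℕ) : Type := UnitAddTorus (Fin d)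

/-- The canonical projection `ℝ^d → ℝ^d / ℤ^d`. -/
def torusProj (d : ℕ) : Eucl d → Torus d := fun x i => (x i : UnitAddCircle)

/-- The one-particle space `L²(Λ; ℂ)`. The inner product is linear in the second argument. -/
abbrev L2 (Λ : Type) [MeasureSpace Λ] : Type := Lp ℂ 2 (volume : Measure Λ)

section Hamiltonian

/- `Λ` is either `ℝ^d` (with `π` the identity) or the torus (with `π` the canonical projection).
Derivatives of functions on `Λ` are taken along the translations `t ↦ x + π (t e_j)`. -/
variable {Λ : Type} [AddCommGroup Λ] [TopologicalSpace Λ] [MeasureSpace Λ] {d : ℕ}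

/-- Smooth compactly supported functions on `Λ`: smoothness is that of the lift to `ℝ^d`. -/
def IsTestFunction (π : Eucl d → Λ) (ψ : Λ → ℂ) : Prop :=
  ContDiff ℝ (⊤ : ℕ∞) (fun x => ψ (π x)) ∧ HasCompactSupport ψ

/-- The partial derivative `∂_j ψ`. -/
def partialDeriv (π : Eucl d → Λ) (j : Fin d) (ψ : Λ → ℂ) (x : Λ) : ℂ :=
  deriv (fun t : ℝ => ψ (x + π (t • EuclideanSpace.single j (1 : ℝ)))) 0

/-- `F` is the weak (distributional) gradient of `f`; both are in `L²`. -/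
def IsWeakGradient (π : Eucl d → Λ) (f : L2 Λ) (F : Fin d → L2 Λ) : Prop :=
  ∀ (j : Fin d) (ψ : Λ → ℂ), IsTestFunction π ψ →
    ∫ x, f x * partialDeriv π j ψ x = -∫ x, F j x * ψ x

/-- `f` is in the form domain of `-Δ + κ + v`, i.e. `f ∈ H¹(Λ)` with weak gradient `F`, and
`v |f|²` is integrable. -/
def InFormDomain (π : Eucl d → Λ) (v : Λ → ℝ) (f : L2 Λ) (F : Fin d → L2 Λ) : Prop :=
  IsWeakGradient π f F ∧ Integrable (fun x => v x * ‖f x‖ ^ 2)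

/-- The graph of the one-body Hamiltonian `h = -Δ + κ + v`, the self-adjoint operator associated
with the closed nonnegative quadratic form `∫ |∇f|² + (κ + v) |f|²`:
`HamiltonianGraph π κ v f g` says that `f` is in the domain of `h` and `h f = g`. -/
def HamiltonianGraph (π : Eucl d → Λ) (κ : ℝ) (v : Λ → ℝ) (f g : L2 Λ) : Prop :=
  ∃ F : Fin d → L2 Λ, InFormDomain π v f F ∧
    ∀ (p : L2 Λ) (P : Fin d → L2 Λ), InFormDomain π v p P →
      ∑ j, ⟪P j, F j⟫_ℂ + ∫ x, ((κ + v x : ℝ) : ℂ) * (star (p x) * f x) = ⟪p, g⟫_ℂ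

/-- `h = ∑ k, lam k u_k u_k^*`: the `u k` form an orthonormal basis of `L²(Λ)` consisting of
eigenfunctions of `h = -Δ + κ + v`, with eigenvalues `lam k` (in any enumeration). -/
def IsSpectralDecomposition (π : Eucl d → Λ) (κ : ℝ) (v : Λ → ℝ)
    (lam : ℕ → ℝ) (u : HilbertBasis ℕ ℂ (L2 Λ)) : Prop :=
  ∀ k, HamiltonianGraph π κ v (u k) ((lam k : ℂ) • u k)

end Hamiltonian

/-- The trace of `h ^ r` for a positive operator `h` with eigenvalues `lam k`, counted with
multiplicity. -/
def tracePow (lam : ℕ → ℝ) (r : ℝ) : ℝ≥0∞ := ∑' k, ENNReal.ofReal (lam k ^ r)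

/-- The standard complex Gaussian measure `π⁻¹ exp (-|z|²) dz` on `ℂ`. -/
def complexGaussian : Measure ℂ :=
  volume.withDensity fun z => ENNReal.ofReal (Real.pi⁻¹ * Real.exp (-‖z‖ ^ 2))

instance : IsProbabilityMeasure complexGaussian := by
  constructor
  have h1 := GaussianFourier.integral_rexp_neg_mul_sq_norm (V := ℂ) (b := 1) one_pos
  have h2 : ∫ z : ℂ, Real.pi⁻¹ * Real.exp (-‖z‖ ^ 2) = 1 := by
    rw [integral_const_mul]
    simp only [neg_mul, one_mul, Complex.finrank_real_complex] at h1
    rw [h1]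
    norm_num [Real.pi_ne_zero]
  rw [complexGaussian, withDensity_apply _ MeasurableSet.univ, Measure.restrict_univ,
    ← ofReal_integral_eq_lintegral_ofReal, h2, ENNReal.ofReal_one]
  · by_contra hc
    rw [integral_undef hc] at h2
    exact zero_ne_one h2
  · exact Filter.Eventually.of_forall fun z => by positivity

/-- The law `μ` of a sequence of independent standard complex Gaussians, on `ℂ^ℕ` with the
product sigma-algebra. -/
def gaussianMeasure : Measure (ℕ → ℂ) := Measure.infinitePi fun _ => complexGaussian

section Interaction

variable {Λ : Type} [AddCommGroup Λ] [MeasureSpace Λ]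

/-- The truncated classical free field
`φ_[K](x) = ∑_{k = 0}^K ω_k / √(lam k) * u_k(x)`. -/
def truncField (lam : ℕ → ℝ) (u : HilbertBasis ℕ ℂ (L2 Λ)) (K : ℕ) (ω : ℕ → ℂ) (x : Λ) : ℂ :=
  ∑ k ∈ Finset.range (K + 1), ω k / (Real.sqrt (lam k) : ℂ) * u k x

/-- The classical density `ϱ_[K](x) = ∫ dμ |φ_[K](x)|²`. -/
def truncDensity (lam : ℕ → ℝ) (u : HilbertBasis ℕ ℂ (L2 Λ)) (K : ℕ) (x : Λ) : ℝ :=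
  ∫ ω, ‖truncField lam u K ω x‖ ^ 2 ∂gaussianMeasure

/-- The truncated Wick-ordered classical interaction
`W_[K] = ½ ∫ dx dy (|φ_[K](x)|² - ϱ_[K](x)) w(x - y) (|φ_[K](y)|² - ϱ_[K](y))`. -/
def truncInteraction (lam : ℕ → ℝ) (u : HilbertBasis ℕ ℂ (L2 Λ)) (w : Λ → ℝ)
    (K : ℕ) (ω : ℕ → ℂ) : ℝ :=
  (1 / 2) * ∫ p : Λ × Λ, (‖truncField lam u K ω p.1‖ ^ 2 - truncDensity lam u K p.1) *
    w (p.1 - p.2) * (‖truncField lam u K ω p.2‖ ^ 2 - truncDensity lam u K p.2)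

end Interaction

/-- A function on `ℝ^d` is of positive type if its Fourier transform, in the sense of tempered
distributions, is a positive measure. -/
def IsPositiveTypeEucl {d : ℕ} (w : Eucl d → ℝ) : Prop :=
  ∃ ν : Measure (Eucl d), ∀ f : 𝓢(Eucl d, ℂ),
    Integrable (fun ξ => f ξ) ν ∧ ∫ ξ, f ξ ∂ν = ∫ x, (w x : ℂ) * 𝓕 (fun ξ => f ξ) x

/-- A function on the torus is of positive type if its Fourier transform, a function on the dual
group `ℤ^d`, is a positive measure, i.e. all Fourier coefficients are nonnegative. -/
def IsPositiveTypeTorus {d : ℕ} (w : Torus d → ℝ) : Prop :=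
  ∀ n : Fin d → ℤ, 0 ≤ ∫ x, UnitAddTorus.mFourier (-n) x * (w x : ℂ)

section Convergence

variable {Ω : Type} [MeasurableSpace Ω]

/-- The sequence `X` lies in `⋂_{1 ≤ m < ∞} L^m(μ)` and is Cauchy in every such `L^m(μ)`. -/
def IsCauchyInAllLp (μ : Measure Ω) (X : ℕ → Ω → ℝ) : Prop :=
  ∀ (m : ℝ≥0∞) [Fact (1 ≤ m)], m ≠ ∞ →
    ∃ hX : ∀ K, MemLp (X K) m μ, CauchySeq fun K => (hX K).toLp (X K)

/-- `Y` lies in `⋂_{1 ≤ m < ∞} L^m(μ)` and `X` converges to `Y` in every such `L^m(μ)`. -/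
def IsLimitInAllLp (μ : Measure Ω) (X : ℕ → Ω → ℝ) (Y : Ω → ℝ) : Prop :=
  ∀ m : ℝ≥0∞, 1 ≤ m → m ≠ ∞ →
    MemLp Y m μ ∧ Tendsto (fun K => eLpNorm (X K - Y) m μ) atTop (𝓝 0)

end Convergence

end WickInteraction

end

open WickInteraction

/-! Positive type makes the interaction a superposition of squares. A bounded `w` of positive type
satisfies `w (x - y) = ∫ e_ξ(x) conj (e_ξ(y)) dν(ξ)` for almost every `(x, y)`, with `ν` a finite
measure and `e_ξ` unimodular characters: plane waves on `ℝ^d`, Fourier modes on the torus. Fubini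
then gives `W_[K] = ½ ∫ |Q_K(ξ)|² dν(ξ)`, where `Q_K(ξ) = ∑_{k, l ≤ K} a_ξ(k, l) (ω_k ω̄_l -
δ_{kl})` and `a_ξ` is the matrix of `h^{-1/2} e_ξ h^{-1/2}` in the eigenbasis
(`truncInteraction_eq_wickSquare`).

The probabilistic input is that every even moment of a centred quadratic form in Gaussians is
controlled by the Hilbert–Schmidt norm of its matrix (`lintegral_quadratic_chaos_pow_le`). It is
proved by decoupling: subtract an independent copy, rotate the pair by `π/4`, and condition on one
of the two.

The operator input is that `|a_ξ(k, l)|² = p(k, l) / (λ_k λ_l)` with `p` doubly substochastic, by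
Bessel's inequality for multiplication by `e_ξ`. A Schur test bounds the Hilbert–Schmidt norm by `∑
λ_k⁻²`, and its part outside the first block by a tail of that series, both uniformly in `ξ`. The
series converges because `λ_k ≥ κ > 0` and `s ≥ -1`. Since `ν` is finite, the estimates integrate
over `ξ` to the Cauchy property in every `L^m` (`isCauchyInAllLp_wickSquare`).

Finiteness of `ν` is where boundedness of `w` enters: test the Fourier identity on dilated bumps on
`ℝ^d`, and on squared Dirichlet-type kernels on the torus. -/

namespace WickInteraction

open ProbabilityTheory ComplexConjugate

/-! ### Complex Gaussians and moments of linear forms. -/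

section Gaussian

lemma integral_complexGaussian_cexp (a : ℂ) (c : ℂ) :
    ∫ z, Complex.exp (a * (⟪c, z⟫_ℝ : ℝ)) ∂complexGaussian = Complex.exp (a ^ 2 * ‖c‖ ^ 2 / 4) := by
  have h := GaussianFourier.integral_cexp_neg_mul_sq_norm_add (V := ℂ) (b := 1) (by simp) a c
  rw [complexGaussian, integral_withDensity_eq_integral_toReal_smul (by fun_prop) (by simp)]
  have h2 : ∀ z : ℂ, (ENNReal.ofReal (Real.pi⁻¹ * Real.exp (-‖z‖ ^ 2))).toReal •
      Complex.exp (a * (⟪c, z⟫_ℝ : ℝ)) = (Real.pi : ℂ)⁻¹ *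
        Complex.exp (-1 * (‖z‖ : ℂ) ^ 2 + a * (⟪c, z⟫_ℝ : ℝ)) := by
    intro z
    rw [ENNReal.toReal_ofReal (by positivity), Complex.exp_add, Complex.real_smul]
    push_cast
    ring_nf
  simp_rw [h2]
  rw [integral_const_mul, h]
  simp [Complex.finrank_real_complex, Real.pi_ne_zero]

lemma complexGaussian_eq_map_stdGaussian :
    complexGaussian = (stdGaussian ℂ).map (fun x => (Real.sqrt 2)⁻¹ • x) := by
  have : IsProbabilityMeasure ((stdGaussian ℂ).map (fun x => (Real.sqrt 2)⁻¹ • x)) :=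
    Measure.isProbabilityMeasure_map (by fun_prop)
  apply Measure.ext_of_charFun
  ext t
  rw [charFun_map_smul, charFun_stdGaussian, charFun_apply]
  have : ∫ x, Complex.exp ((⟪x, t⟫_ℝ : ℝ) * Complex.I) ∂complexGaussian =
      Complex.exp (Complex.I ^ 2 * ‖t‖ ^ 2 / 4) := by
    rw [← integral_complexGaussian_cexp]
    congr with x
    rw [mul_comm, real_inner_comm]
  rw [this, norm_smul]
  have h2 : ((Real.sqrt 2 : ℝ) : ℂ) ^ 2 = 2 := by
    rw [← Complex.ofReal_pow, Real.sq_sqrt (by norm_num)]; simp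
  simp [mul_pow, h2, abs_of_nonneg (Real.sqrt_nonneg 2)]
  ring_nf

instance : IsGaussian complexGaussian := by
  rw [complexGaussian_eq_map_stdGaussian]
  exact isGaussian_map ((Real.sqrt 2)⁻¹ • ContinuousLinearMap.id ℝ ℂ)

lemma integral_id_complexGaussian : ∫ z, z ∂complexGaussian = 0 := by
  rw [complexGaussian_eq_map_stdGaussian, integral_map (by fun_prop) (by fun_prop),
    integral_smul, integral_id_stdGaussian, smul_zero]

lemma lintegral_complexGaussian_exp (c : ℂ) :
    ∫⁻ z, ENNReal.ofReal (Real.exp ⟪c, z⟫_ℝ) ∂complexGaussian =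
      ENNReal.ofReal (Real.exp (‖c‖ ^ 2 / 4)) := by
  have h : ∫ z, Real.exp ⟪c, z⟫_ℝ ∂complexGaussian = Real.exp (‖c‖ ^ 2 / 4) := by
    have := integral_complexGaussian_cexp 1 c
    simp only [one_mul, one_pow, ← Complex.ofReal_exp] at this
    rw [integral_complex_ofReal] at this
    apply Complex.ofReal_injective
    rw [this]
    push_cast
    rfl
  rw [← ofReal_integral_eq_lintegral_ofReal, h]
  · by_contra hc
    rw [integral_undef hc] at h
    exact (Real.exp_pos _).ne h
  · exact Eventually.of_forall fun z => (Real.exp_pos _).le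

variable {ι : Type*} [Fintype ι]

/-- The law of finitely many independent standard complex Gaussians. -/
noncomputable abbrev gaussianPi (ι : Type*) [Fintype ι] : Measure (ι → ℂ) :=
  Measure.pi fun _ => complexGaussian

lemma lintegral_gaussianPi_exp (c : ι → ℂ) :
    ∫⁻ z, ENNReal.ofReal (Real.exp (∑ k, (c k * z k).re)) ∂(gaussianPi ι) =
      ENNReal.ofReal (Real.exp ((∑ k, ‖c k‖ ^ 2) / 4)) := by
  have hind := iIndepFun_pi (μ := fun _ : ι => complexGaussian)
    (X := fun k z => ENNReal.ofReal (Real.exp (c k * z).re)) (fun k => by fun_prop)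
  have h := lintegral_prod_eq_prod_lintegral_of_indepFun Finset.univ _ hind
    (fun k => by fun_prop)
  simp_rw [Real.exp_sum, ENNReal.ofReal_prod_of_nonneg (fun _ _ => (Real.exp_pos _).le)]
  rw [h, Finset.sum_div, Real.exp_sum,
    ENNReal.ofReal_prod_of_nonneg (fun _ _ => (Real.exp_pos _).le)]
  refine Finset.prod_congr rfl fun k _ => ?_
  have h1 := lintegral_complexGaussian_exp (conj (c k))
  rw [RCLike.norm_conj] at h1
  rw [← h1]
  have hm := (measurePreserving_eval (fun _ : ι => complexGaussian) k).lintegral_comp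
    (f := fun z => ENNReal.ofReal (Real.exp (c k * z).re)) (by fun_prop)
  simp only [Function.eval] at hm
  rw [hm]
  congr with z
  congr 2
  simp [Complex.inner]
  ring

/-- The constant in the moment bounds for linear forms in Gaussians. -/
noncomputable def linearMomentConst (m : ℕ) : ℝ := m.factorial * (4 * Real.exp (1 / 2))

/-- `|S| ≤ |Re S| + |Im S|`, and whatever the signs, one of the four exponents equals the right-hand
side. This trades a moment for exponential moments of real linear forms, which are explicit. -/
lemma pow_le_factorial_mul_exp_norm (m : ℕ) (S : ℂ) :
    ‖S‖ ^ m ≤ m.factorial * (Real.exp (((1 + Complex.I) * S).re) +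
      Real.exp (((1 - Complex.I) * S).re) + Real.exp (((-1 + Complex.I) * S).re) +
      Real.exp (((-1 - Complex.I) * S).re)) := by
  have h1 : ‖S‖ ^ m ≤ m.factorial * Real.exp ‖S‖ := by
    have := Real.pow_div_factorial_le_exp ‖S‖ (norm_nonneg _) m
    rwa [div_le_iff₀' (by positivity)] at this
  refine h1.trans ?_
  gcongr
  have h2 : Real.exp ‖S‖ ≤ Real.exp (|S.re| + |S.im|) :=
    Real.exp_le_exp.2 (Complex.norm_le_abs_re_add_abs_im S)
  refine h2.trans ?_
  simp only [Complex.mul_re, Complex.add_re, Complex.sub_re, Complex.add_im, Complex.sub_im,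
    Complex.neg_re, Complex.neg_im, Complex.one_re, Complex.one_im, Complex.I_re, Complex.I_im]
  have p1 := Real.exp_pos (S.re - S.im)
  have p2 := Real.exp_pos (S.re + S.im)
  have p3 := Real.exp_pos (-S.re - S.im)
  have p4 := Real.exp_pos (-S.re + S.im)
  ring_nf at *
  rcases abs_cases S.re with ⟨h, -⟩ | ⟨h, -⟩ <;> rcases abs_cases S.im with ⟨h', -⟩ | ⟨h', -⟩ <;>
    simp only [h, h', ← sub_eq_add_neg] <;> linarith

lemma lintegral_linear_pow_le_of_sum_eq_one (m : ℕ) (c : ι → ℂ) (hc : ∑ k, ‖c k‖ ^ 2 = 1) :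
    ∫⁻ z, ‖∑ k, c k * z k‖ₑ ^ m ∂(gaussianPi ι) ≤ ENNReal.ofReal (linearMomentConst m) := by
  -- Each corner `ζ = ±1 ± i` has `|ζ|² = 2`, so the exponent is `2 / 4 = 1 / 2`; four corners
  -- produce the factor `4 * exp (1 / 2)`.
  have key : ∀ ζ : ℂ, ‖ζ‖ ^ 2 = 2 →
      ∫⁻ z, ENNReal.ofReal (Real.exp ((ζ * ∑ k, c k * z k).re)) ∂(gaussianPi ι) =
        ENNReal.ofReal (Real.exp (1 / 2)) := by
    intro ζ hζ
    have := lintegral_gaussianPi_exp (fun k => ζ * c k)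
    simp_rw [norm_mul, mul_pow, ← Finset.mul_sum, hc, hζ] at this
    simp_rw [Finset.mul_sum, Complex.re_sum, ← mul_assoc]
    rw [this]
    norm_num
  have k1 := key (1 + Complex.I) (by rw [Complex.sq_norm, Complex.normSq_apply]; norm_num)
  have k2 := key (1 - Complex.I) (by rw [Complex.sq_norm, Complex.normSq_apply]; norm_num)
  have k3 := key (-1 + Complex.I) (by rw [Complex.sq_norm, Complex.normSq_apply]; norm_num)
  have k4 := key (-1 - Complex.I) (by rw [Complex.sq_norm, Complex.normSq_apply]; norm_num)
  calc ∫⁻ z, ‖∑ k, c k * z k‖ₑ ^ m ∂(gaussianPi ι)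
      ≤ ∫⁻ z, ENNReal.ofReal m.factorial * (
          ENNReal.ofReal (Real.exp (((1 + Complex.I) * ∑ k, c k * z k).re)) +
          ENNReal.ofReal (Real.exp (((1 - Complex.I) * ∑ k, c k * z k).re)) +
          ENNReal.ofReal (Real.exp (((-1 + Complex.I) * ∑ k, c k * z k).re)) +
          ENNReal.ofReal (Real.exp (((-1 - Complex.I) * ∑ k, c k * z k).re)))
          ∂(gaussianPi ι) := by
        refine lintegral_mono fun z => ?_
        rw [← ofReal_norm, ← ENNReal.ofReal_pow (norm_nonneg _),
          ← ENNReal.ofReal_add (by positivity) (by positivity),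
          ← ENNReal.ofReal_add (by positivity) (by positivity),
          ← ENNReal.ofReal_add (by positivity) (by positivity),
          ← ENNReal.ofReal_mul (by positivity)]
        exact ENNReal.ofReal_le_ofReal (pow_le_factorial_mul_exp_norm m _)
    _ = ENNReal.ofReal (linearMomentConst m) := by
        rw [lintegral_const_mul _ (by fun_prop), lintegral_add_left (by fun_prop),
          lintegral_add_left (by fun_prop), lintegral_add_left (by fun_prop), k1, k2, k3, k4,
          ← ENNReal.ofReal_add (by positivity) (by positivity),
          ← ENNReal.ofReal_add (by positivity) (by positivity),
          ← ENNReal.ofReal_add (by positivity) (by positivity),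
          ← ENNReal.ofReal_mul (by positivity), linearMomentConst]
        congr 1
        ring

/-- Homogeneity reduces to unit coefficient vectors; the zero vector cannot be normalised and is
treated apart. -/
lemma lintegral_linear_pow_le {n : ℕ} (hn : n ≠ 0) (c : ι → ℂ) :
    ∫⁻ z, ‖∑ k, c k * z k‖ₑ ^ (2 * n) ∂(gaussianPi ι) ≤
      ENNReal.ofReal (linearMomentConst (2 * n)) * (∑ k, ‖c k‖ₑ ^ 2) ^ n := by
  have hsum : ∑ k, ‖c k‖ₑ ^ 2 = ENNReal.ofReal (∑ k, ‖c k‖ ^ 2) := by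
    rw [ENNReal.ofReal_sum_of_nonneg (fun _ _ => by positivity)]
    simp_rw [← ofReal_norm, ENNReal.ofReal_pow (norm_nonneg _)]
  rcases eq_or_ne (∑ k, ‖c k‖ ^ 2) 0 with h0 | h0
  · have : ∀ k, c k = 0 := by
      intro k
      have := (Finset.sum_eq_zero_iff_of_nonneg (fun _ _ => by positivity)).1 h0 k (Finset.mem_univ _)
      simpa using this
    simp [this, hn]
  · have hpos : 0 < ∑ k, ‖c k‖ ^ 2 :=
      lt_of_le_of_ne (Finset.sum_nonneg fun _ _ => by positivity) h0.symm
    set σ := Real.sqrt (∑ k, ‖c k‖ ^ 2) with hσ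
    have hσ0 : 0 < σ := Real.sqrt_pos.2 hpos
    have hσ2 : σ ^ 2 = ∑ k, ‖c k‖ ^ 2 := Real.sq_sqrt hpos.le
    have h1 := lintegral_linear_pow_le_of_sum_eq_one (2 * n) (fun k => (σ : ℂ)⁻¹ * c k) (by
      simp_rw [norm_mul, mul_pow, ← Finset.mul_sum, ← hσ2]
      simp [abs_of_pos hσ0, hσ0.ne'])
    have h2 : ∀ z : ι → ℂ, ‖∑ k, c k * z k‖ₑ ^ (2 * n) =
        (ENNReal.ofReal (σ ^ 2)) ^ n * ‖∑ k, (σ : ℂ)⁻¹ * c k * z k‖ₑ ^ (2 * n) := by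
      intro z
      simp_rw [mul_assoc, ← Finset.mul_sum]
      rw [enorm_mul, mul_pow, ← mul_assoc, ENNReal.ofReal_pow hσ0.le, ← pow_mul, ← mul_pow]
      have : ENNReal.ofReal σ * ‖(σ : ℂ)⁻¹‖ₑ = 1 := by
        rw [← ofReal_norm, ← ENNReal.ofReal_mul hσ0.le]
        simp [abs_of_pos hσ0, hσ0.ne']
      rw [this, one_pow, one_mul]
    simp_rw [h2]
    rw [lintegral_const_mul _ (by fun_prop), hsum, hσ2, mul_comm]
    gcongr

end Gaussian

/-! ### Power-mean and Minkowski inequalities for lower Lebesgue integrals. -/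

section Lintegral

variable {Ω : Type*} [MeasurableSpace Ω] {ν : Measure Ω}

lemma eLpNorm_natCast_pow {n : ℕ} (hn : n ≠ 0) {E : Type*} [TopologicalSpace E]
    [ESeminormedAddMonoid E] (f : Ω → E) : eLpNorm f n ν ^ n = ∫⁻ x, ‖f x‖ₑ ^ n ∂ν := by
  rw [eLpNorm_eq_lintegral_rpow_enorm_toReal (by simpa using hn) (by simp), ← ENNReal.rpow_natCast,
    ← ENNReal.rpow_mul]
  simp [hn]

lemma lintegral_pow_le_measure_univ_mul {n : ℕ} (hn : n ≠ 0) {f : Ω → ℝ≥0∞}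
    (hf : AEMeasurable f ν) :
    (∫⁻ x, f x ∂ν) ^ n ≤ ν Set.univ ^ (n - 1) * ∫⁻ x, f x ^ n ∂ν := by
  have h1 : (1 : ℝ≥0∞) ≤ n := by exact_mod_cast Nat.one_le_iff_ne_zero.2 hn
  have h := eLpNorm_le_eLpNorm_mul_rpow_measure_univ h1 hf.aestronglyMeasurable
  have h2 := pow_le_pow_left' h n
  rw [mul_pow, eLpNorm_natCast_pow hn, eLpNorm_one_eq_lintegral_enorm] at h2
  simp only [enorm_eq_self] at h2
  refine h2.trans (le_of_eq ?_)
  rw [mul_comm]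
  congr 1
  rw [← ENNReal.rpow_natCast, ← ENNReal.rpow_mul, ← ENNReal.rpow_natCast]
  congr 1
  have : (n : ℝ) ≠ 0 := by exact_mod_cast hn
  rw [Nat.cast_sub (Nat.one_le_iff_ne_zero.2 hn)]
  simp
  field_simp

/-- Minkowski's inequality for a finite sum whose terms have known moment bounds. -/
lemma lintegral_sum_pow_le {κ : Type*} (s : Finset κ) {n : ℕ} (hn : n ≠ 0) {f : κ → Ω → ℝ≥0∞}
    (hf : ∀ k, AEMeasurable (f k) ν) (C : ℝ≥0∞) (a : κ → ℝ≥0∞)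
    (h : ∀ k, ∫⁻ x, f k x ^ n ∂ν ≤ C * a k ^ n) :
    ∫⁻ x, (∑ k ∈ s, f k x) ^ n ∂ν ≤ C * (∑ k ∈ s, a k) ^ n := by
  have h1 : (1 : ℝ≥0∞) ≤ n := by exact_mod_cast Nat.one_le_iff_ne_zero.2 hn
  have hn' : (n : ℝ) ≠ 0 := by exact_mod_cast hn
  have hroot : ∀ x : ℝ≥0∞, (x ^ ((n : ℝ)⁻¹)) ^ n = x := fun x => by
    rw [← ENNReal.rpow_natCast, ← ENNReal.rpow_mul, inv_mul_cancel₀ hn', ENNReal.rpow_one]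
  have hb : ∀ k, eLpNorm (f k) n ν ≤ C ^ ((n : ℝ)⁻¹) * a k := by
    intro k
    rw [← ENNReal.pow_le_pow_left_iff hn, eLpNorm_natCast_pow hn, mul_pow, hroot]
    simpa using h k
  have hs := eLpNorm_sum_le (s := s) (fun k _ => (hf k).aestronglyMeasurable) h1
  have := pow_le_pow_left' (hs.trans (Finset.sum_le_sum fun k _ => hb k)) n
  rw [eLpNorm_natCast_pow hn, ← Finset.mul_sum, mul_pow, hroot] at this
  simpa using this

end Lintegral

/-! ### Moments of centred quadratic forms by decoupling. -/

section Chaos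

variable {ι : Type*} [Fintype ι]

lemma integral_norm_sq_complexGaussian : ∫ z, ‖z‖ ^ 2 ∂complexGaussian = 1 := by
  have h := Complex.integral_rpow_mul_exp_neg_rpow (p := 2) (q := 2) (by norm_num) (by norm_num)
  rw [complexGaussian, integral_withDensity_eq_integral_toReal_smul (by fun_prop) (by simp)]
  have h2 : ∀ z : ℂ, (ENNReal.ofReal (Real.pi⁻¹ * Real.exp (-‖z‖ ^ 2))).toReal • ‖z‖ ^ 2 =
      Real.pi⁻¹ * (‖z‖ ^ (2 : ℝ) * Real.exp (-‖z‖ ^ (2 : ℝ))) := by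
    intro z
    rw [ENNReal.toReal_ofReal (by positivity), smul_eq_mul]
    norm_num
    ring
  simp_rw [h2]
  rw [integral_const_mul, h]
  norm_num [Real.pi_ne_zero]

lemma memLp_eval_gaussianPi (k : ι) : MemLp (fun z : ι → ℂ => z k) 2 (gaussianPi ι) :=
  (IsGaussian.memLp_id complexGaussian 2 (by simp)).comp_measurePreserving
    (measurePreserving_eval (fun _ : ι => complexGaussian) k)

lemma integrable_mul_conj_gaussianPi (k l : ι) :
    Integrable (fun z : ι → ℂ => z k * conj (z l)) (gaussianPi ι) :=
  (memLp_eval_gaussianPi k).integrable_mul (memLp_eval_gaussianPi l).star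

lemma integral_mul_conj_gaussianPi [DecidableEq ι] (k l : ι) :
    ∫ z : ι → ℂ, z k * conj (z l) ∂(gaussianPi ι) = if k = l then 1 else 0 := by
  split_ifs with hkl
  · subst hkl
    have h := integral_map (μ := gaussianPi ι) (f := fun z : ℂ => z * conj z)
      (measurable_pi_apply k).aemeasurable (by fun_prop)
    rw [(measurePreserving_eval (fun _ : ι => complexGaussian) k).map_eq] at h
    rw [← h]
    simp_rw [Complex.mul_conj, Complex.normSq_eq_norm_sq]
    rw [integral_complex_ofReal, integral_norm_sq_complexGaussian, Complex.ofReal_one]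
  · have hind := iIndepFun_pi (μ := fun _ : ι => complexGaussian)
      (X := fun _ (z : ℂ) => z) (fun k => by fun_prop)
    have hind2 := (hind.indepFun hkl).comp measurable_id Complex.continuous_conj.measurable
    have := hind2.integral_fun_mul_eq_mul_integral
      (measurable_pi_apply k).aestronglyMeasurable
      (Complex.continuous_conj.measurable.comp (measurable_pi_apply l)).aestronglyMeasurable
    simp only [Function.comp_def, id] at this
    rw [this]
    have h := integral_map (μ := gaussianPi ι) (f := fun z : ℂ => z)
      (measurable_pi_apply k).aemeasurable (by fun_prop)
    rw [(measurePreserving_eval (fun _ : ι => complexGaussian) k).map_eq,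
      integral_id_complexGaussian] at h
    rw [← h, zero_mul]

/-- A pair of independent copies is, coordinate by coordinate, a pair of independent centred
Gaussians of the same law, and such a pair is rotation invariant. -/
lemma measurePreserving_rotation_gaussianPi (θ : ℝ) :
    MeasurePreserving (fun p : (ι → ℂ) × (ι → ℂ) =>
      (Real.cos θ • p.1 + Real.sin θ • p.2, -Real.sin θ • p.1 + Real.cos θ • p.2))
      ((gaussianPi ι).prod (gaussianPi ι)) ((gaussianPi ι).prod (gaussianPi ι)) := by
  have h1 := measurePreserving_arrowProdEquivProdArrow ℂ ℂ ι (fun _ => complexGaussian)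
    (fun _ => complexGaussian)
  have h0 : MeasurePreserving (ContinuousLinearMap.rotation (E := ℂ) θ)
      (complexGaussian.prod complexGaussian) (complexGaussian.prod complexGaussian) :=
    ⟨by fun_prop, IsGaussian.map_rotation_eq_self integral_id_complexGaussian θ⟩
  have h2 := measurePreserving_pi _ _ (fun _ : ι => h0)
  exact h1.comp (h2.comp (h1.symm _))

lemma integral_quadratic_gaussianPi (A : ι → ι → ℂ) :
    ∫ z : ι → ℂ, ∑ k, ∑ l, A k l * (z k * conj (z l)) ∂(gaussianPi ι) = ∑ k, A k k := by
  classical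
  rw [integral_finsetSum _ fun k _ => integrable_finsetSum _ fun l _ =>
    (integrable_mul_conj_gaussianPi k l).const_mul _]
  refine Finset.sum_congr rfl fun k _ => ?_
  rw [integral_finsetSum _ fun l _ => (integrable_mul_conj_gaussianPi k l).const_mul _]
  simp_rw [integral_const_mul, integral_mul_conj_gaussianPi]
  simp

/-- Moment bound for a decoupled quadratic form in Gaussians. -/
lemma lintegral_bilinear_pow_le {n : ℕ} (hn : n ≠ 0) (A : ι → ι → ℂ) :
    ∫⁻ p : (ι → ℂ) × (ι → ℂ), ‖∑ k, ∑ l, A k l * (p.1 k * conj (p.2 l))‖ₑ ^ (2 * n)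
        ∂((gaussianPi ι).prod (gaussianPi ι)) ≤
      ENNReal.ofReal (linearMomentConst (2 * n)) ^ 2 * (∑ k, ∑ l, ‖A k l‖ₑ ^ 2) ^ n := by
  set C := ENNReal.ofReal (linearMomentConst (2 * n))
  rw [lintegral_prod_symm _ (by fun_prop)]
  -- With `z'` frozen the form is linear in `z`, with coefficients that are themselves linear in the
  -- conjugate of `z'`.
  have h1 : ∀ z' : ι → ℂ, ∫⁻ z : ι → ℂ,
      ‖∑ k, ∑ l, A k l * (z k * conj (z' l))‖ₑ ^ (2 * n) ∂(gaussianPi ι) ≤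
        C * (∑ k, ‖∑ l, conj (A k l) * z' l‖ₑ ^ 2) ^ n := by
    intro z'
    have h := lintegral_linear_pow_le hn (fun k => conj (∑ l, conj (A k l) * z' l))
    simp only [RCLike.enorm_conj] at h
    refine le_trans (le_of_eq ?_) h
    congr with z
    congr 3 with k
    simp only [map_sum, map_mul, Complex.conj_conj, Finset.sum_mul]
    exact Finset.sum_congr rfl fun l _ => by ring
  refine (lintegral_mono h1).trans ?_
  rw [lintegral_const_mul _ (by fun_prop), pow_two, mul_assoc]
  gcongr
  -- Minkowski is applied in `L^n` to the squared coefficients, so the linear bound at exponent `2 *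
  -- n` is used a second time.
  refine lintegral_sum_pow_le _ hn (fun k => Measurable.aemeasurable (by fun_prop)) C _ fun k => ?_
  simp_rw [← pow_mul]
  simpa using lintegral_linear_pow_le hn (fun l => conj (A k l))

/-- Moment bound for a centred quadratic form in Gaussians. -/
theorem lintegral_quadratic_chaos_pow_le {n : ℕ} (hn : n ≠ 0) (A : ι → ι → ℂ) :
    ∫⁻ z : ι → ℂ, ‖∑ k, ∑ l, A k l * (z k * conj (z l)) - ∑ k, A k k‖ₑ ^ (2 * n) ∂(gaussianPi ι) ≤
      2 ^ (2 * n) * ENNReal.ofReal (linearMomentConst (2 * n)) ^ 2 *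
        (∑ k, ∑ l, ‖A k l‖ₑ ^ 2) ^ n := by
  set C := ENNReal.ofReal (linearMomentConst (2 * n))
  set q : (ι → ℂ) → ℂ := fun z => ∑ k, ∑ l, A k l * (z k * conj (z l)) with hq
  have h2n : 2 * n ≠ 0 := by omega
  have hqm : Measurable q := by fun_prop
  have hqi : Integrable q (gaussianPi ι) := integrable_finsetSum _ fun k _ =>
    integrable_finsetSum _ fun l _ => (integrable_mul_conj_gaussianPi k l).const_mul _
  -- The trace is the mean of `q`, so centring is averaging over an independent copy; Jensen moves
  -- the power inside.
  have h1 : ∀ z, ‖q z - ∑ k, A k k‖ₑ ^ (2 * n) ≤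
      ∫⁻ z', ‖q z - q z'‖ₑ ^ (2 * n) ∂(gaussianPi ι) := by
    intro z
    have : q z - ∑ k, A k k = ∫ z', (q z - q z') ∂(gaussianPi ι) := by
      rw [integral_sub (integrable_const _) hqi, integral_quadratic_gaussianPi]
      simp
    rw [this]
    refine (pow_le_pow_left' (enorm_integral_le_lintegral_enorm _) _).trans ?_
    refine (lintegral_pow_le_measure_univ_mul h2n (by fun_prop)).trans ?_
    simp
  refine (lintegral_mono h1).trans ?_
  rw [← lintegral_prod (fun p : (ι → ℂ) × (ι → ℂ) => ‖q p.1 - q p.2‖ₑ ^ (2 * n)) (by fun_prop),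
    ← (measurePreserving_rotation_gaussianPi (ι := ι) (Real.pi / 4)).lintegral_comp (by fun_prop)]
  set B : (ι → ℂ) × (ι → ℂ) → ℂ := fun p => ∑ k, ∑ l, A k l * (p.1 k * conj (p.2 l)) with hB
  -- At angle `π/4` the terms quadratic in one variable cancel, and the cross terms carry the factor
  -- `2 cos sin = 1`: only decoupled forms remain.
  have h3 : ∀ p : (ι → ℂ) × (ι → ℂ),
      q (Real.cos (Real.pi / 4) • p.1 + Real.sin (Real.pi / 4) • p.2) -
      q (-Real.sin (Real.pi / 4) • p.1 + Real.cos (Real.pi / 4) • p.2) = B p + B p.swap := by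
    intro p
    simp only [hq, hB, ← Finset.sum_sub_distrib, ← Finset.sum_add_distrib]
    refine Finset.sum_congr rfl fun k _ => Finset.sum_congr rfl fun l _ => ?_
    have hs : ((Real.sqrt 2 : ℝ) : ℂ) ^ 2 = 2 := by
      rw [← Complex.ofReal_pow, Real.sq_sqrt (by norm_num)]; simp
    simp only [Real.cos_pi_div_four, Real.sin_pi_div_four, Pi.add_apply, Pi.smul_apply,
      Complex.real_smul, map_add, map_mul, Complex.conj_ofReal, Prod.fst_swap, Prod.snd_swap]
    push_cast
    linear_combination (A k l * (p.1 k * conj (p.2 l) + p.2 k * conj (p.1 l)) / 2) * hs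
  simp_rw [h3]
  have hBm : Measurable B := by fun_prop
  have hB1 := lintegral_bilinear_pow_le hn A
  have hB2 : ∫⁻ p, ‖B p.swap‖ₑ ^ (2 * n) ∂((gaussianPi ι).prod (gaussianPi ι)) ≤
      C ^ 2 * (∑ k, ∑ l, ‖A k l‖ₑ ^ 2) ^ n := by
    rwa [(Measure.measurePreserving_swap (μ := gaussianPi ι) (ν := gaussianPi ι)).lintegral_comp
      (f := fun p => ‖B p‖ₑ ^ (2 * n)) (by fun_prop)]
  -- Minkowski for two terms indexed by `Bool`, with weights `1`; this is the source of `2 ^ (2 *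
  -- n)`.
  have h4 := lintegral_sum_pow_le (ν := (gaussianPi ι).prod (gaussianPi ι)) Finset.univ h2n
    (f := fun b : Bool => fun p => if b then ‖B p‖ₑ else ‖B p.swap‖ₑ)
    (by intro b; cases b <;> simp <;> fun_prop)
    (C ^ 2 * (∑ k, ∑ l, ‖A k l‖ₑ ^ 2) ^ n) (fun _ => 1)
    (by intro b; cases b <;> simp <;> assumption)
  simp only [Fintype.sum_bool, if_true, Bool.false_eq_true, if_false] at h4
  calc _ ≤ ∫⁻ p, (‖B p‖ₑ + ‖B p.swap‖ₑ) ^ (2 * n) ∂((gaussianPi ι).prod (gaussianPi ι)) :=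
        lintegral_mono fun p => pow_le_pow_left' (enorm_add_le _ _) _
    _ ≤ _ := h4
    _ = _ := by rw [one_add_one_eq_two]; ring

end Chaos

/-! ### Cauchy sequences and common limits in all `L^m`. -/

section LpLimits

variable {Ω : Type} [MeasurableSpace Ω] {μ : Measure Ω} {X : ℕ → Ω → ℝ}

lemma ae_eq_of_tendsto_eLpNorm_one {Y Z : Ω → ℝ} (hX : ∀ K, AEStronglyMeasurable (X K) μ)
    (hY : AEStronglyMeasurable Y μ) (hZ : AEStronglyMeasurable Z μ)
    (hXY : Tendsto (fun K => eLpNorm (X K - Y) 1 μ) atTop (𝓝 0))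
    (hXZ : Tendsto (fun K => eLpNorm (X K - Z) 1 μ) atTop (𝓝 0)) : Y =ᵐ[μ] Z := by
  have h : eLpNorm (Y - Z) 1 μ = 0 := by
    refine le_antisymm (ge_of_tendsto' (by simpa using hXY.add hXZ) fun K => ?_) zero_le
    have h1 : Y - Z = (X K - Z) - (X K - Y) := by abel
    rw [h1, add_comm]
    exact eLpNorm_sub_le ((hX K).sub hZ) ((hX K).sub hY) le_rfl
  rw [eLpNorm_eq_zero_iff (hY.sub hZ) one_ne_zero] at h
  filter_upwards [h] with ω hω
  exact sub_eq_zero.1 hω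

lemma IsLimitInAllLp.ae_eq {Y Z : Ω → ℝ} (hX : ∀ K, AEStronglyMeasurable (X K) μ)
    (hY : IsLimitInAllLp μ X Y) (hZ : IsLimitInAllLp μ X Z) : Z =ᵐ[μ] Y :=
  ae_eq_of_tendsto_eLpNorm_one hX (hZ 1 le_rfl (by simp)).1.1 (hY 1 le_rfl (by simp)).1.1
    (hZ 1 le_rfl (by simp)).2 (hY 1 le_rfl (by simp)).2

variable [IsProbabilityMeasure μ]

/-- Completeness gives a limit for each `m` separately. On a probability space convergence in `L^m`
implies convergence in `L¹`, so all of them agree almost surely with the `L¹` limit. -/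
theorem IsCauchyInAllLp.exists_limit (hX : ∀ K, AEStronglyMeasurable (X K) μ)
    (h : IsCauchyInAllLp μ X) : ∃ W : Ω → ℝ, IsLimitInAllLp μ X W := by
  have key : ∀ m : ℝ≥0∞, 1 ≤ m → m ≠ ∞ → ∃ Y : Ω → ℝ, MemLp Y m μ ∧
      Tendsto (fun K => eLpNorm (X K - Y) m μ) atTop (𝓝 0) := by
    intro m hm hm'
    have : Fact (1 ≤ m) := ⟨hm⟩
    obtain ⟨hmem, hc⟩ := h m hm'
    obtain ⟨Y, hY⟩ := cauchySeq_tendsto_of_complete hc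
    refine ⟨Y, Lp.memLp Y, ?_⟩
    rw [Lp.tendsto_Lp_iff_tendsto_eLpNorm'] at hY
    refine hY.congr fun K => eLpNorm_congr_ae ?_
    exact (hmem K).coeFn_toLp.sub EventuallyEq.rfl
  obtain ⟨W, hW, hWlim⟩ := key 1 le_rfl (by simp)
  refine ⟨W, fun m hm hm' => ?_⟩
  obtain ⟨Y, hY, hYlim⟩ := key m hm hm'
  have hY1 : Tendsto (fun K => eLpNorm (X K - Y) 1 μ) atTop (𝓝 0) :=
    tendsto_of_tendsto_of_tendsto_of_le_of_le tendsto_const_nhds hYlim (fun _ => zero_le)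
      fun K => eLpNorm_le_eLpNorm_of_exponent_le hm ((hX K).sub hY.1)
  have hYW := ae_eq_of_tendsto_eLpNorm_one hX hY.1 hW.1 hY1 hWlim
  exact ⟨hY.ae_eq hYW, hYlim.congr fun K => eLpNorm_congr_ae (EventuallyEq.rfl.sub hYW)⟩

/-- Cauchy bounds on all integer moments give the Cauchy property in all `L^m`. -/
theorem isCauchyInAllLp_of_moments (hX : ∀ K, AEStronglyMeasurable (X K) μ)
    (hfin : ∀ n : ℕ, n ≠ 0 → ∀ K, ∫⁻ ω, ‖X K ω‖ₑ ^ n ∂μ < ∞)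
    (hcauchy : ∀ n : ℕ, n ≠ 0 → ∃ B : ℕ → ℝ≥0∞, Tendsto B atTop (𝓝 0) ∧
      ∀ L K, L ≤ K → ∫⁻ ω, ‖X K ω - X L ω‖ₑ ^ n ∂μ ≤ B L) :
    IsCauchyInAllLp μ X := by
  intro m hm hm'
  -- Norms increase with the exponent on a probability space, so an integer above `m` suffices.
  obtain ⟨n, hn⟩ := ENNReal.exists_nat_gt hm'
  have hn0 : n ≠ 0 := by
    rintro rfl
    simp at hn
  have hmem : ∀ K, MemLp (X K) m μ := fun K => by
    have : MemLp (X K) n μ := ⟨hX K, by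
      refine (ENNReal.pow_lt_top_iff (n := n)).1 ?_ |>.resolve_right hn0
      rw [eLpNorm_natCast_pow hn0]
      exact hfin n hn0 K⟩
    exact this.mono_exponent hn.le
  refine ⟨hmem, ?_⟩
  obtain ⟨B, hB, hle⟩ := hcauchy n hn0
  rw [EMetric.cauchySeq_iff']
  intro ε hε
  have hev := hB.eventually (gt_mem_nhds (ENNReal.pow_pos hε n))
  obtain ⟨L, hL⟩ := hev.exists
  refine ⟨L, fun K hK => ?_⟩
  rw [Lp.edist_toLp_toLp]
  refine (eLpNorm_le_eLpNorm_of_exponent_le hn.le ((hX K).sub (hX L))).trans_lt ?_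
  rw [← ENNReal.pow_lt_pow_left_iff hn0, eLpNorm_natCast_pow hn0]
  exact (hle L K hK).trans_lt hL

end LpLimits

/-! ### Centred quadratic forms on the infinite product. -/

section WickForm

/-- The centred quadratic form `∑_{k, l ∈ I} A k l (ω_k ω̄_l - δ_{k l})`. -/
noncomputable def wickForm (I : Finset ℕ) (A : ℕ → ℕ → ℂ) (ω : ℕ → ℂ) : ℂ :=
  ∑ k ∈ I, ∑ l ∈ I, A k l * (ω k * conj (ω l)) - ∑ k ∈ I, A k k

@[fun_prop]
lemma measurable_wickForm (I : Finset ℕ) (A : ℕ → ℕ → ℂ) : Measurable (wickForm I A) := by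
  unfold wickForm
  fun_prop

lemma measurePreserving_restrict_gaussianMeasure (I : Finset ℕ) :
    MeasurePreserving (I.restrict : (ℕ → ℂ) → (I → ℂ)) gaussianMeasure (gaussianPi I) :=
  ⟨by fun_prop, Measure.infinitePi_map_restrict _⟩

instance : IsProbabilityMeasure gaussianMeasure := by
  unfold gaussianMeasure
  infer_instance

/-- The constant in the moment bounds for centred quadratic forms in Gaussians. -/
noncomputable def chaosMomentConst (n : ℕ) : ℝ≥0∞ :=
  2 ^ (2 * n) * ENNReal.ofReal (linearMomentConst (2 * n)) ^ 2

lemma chaosMomentConst_ne_top (n : ℕ) : chaosMomentConst n ≠ ∞ := by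
  unfold chaosMomentConst
  finiteness

lemma lintegral_wickForm_pow_le {n : ℕ} (hn : n ≠ 0) (I : Finset ℕ) (A : ℕ → ℕ → ℂ) :
    ∫⁻ ω, ‖wickForm I A ω‖ₑ ^ (2 * n) ∂gaussianMeasure ≤
      chaosMomentConst n * (∑ k ∈ I, ∑ l ∈ I, ‖A k l‖ₑ ^ 2) ^ n := by
  have h := lintegral_quadratic_chaos_pow_le hn (fun k l : I => A k l)
  rw [← (measurePreserving_restrict_gaussianMeasure I).lintegral_comp (by fun_prop)] at h
  simp_rw [← Finset.sum_coe_sort I]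
  refine le_trans (le_of_eq ?_) h
  congr with ω
  congr 2
  simp only [wickForm, ← Finset.sum_coe_sort I]
  rfl

lemma integral_norm_sq_linear_gaussianMeasure (I : Finset ℕ) (c : ℕ → ℂ) :
    ∫ ω, ((‖∑ k ∈ I, c k * ω k‖ ^ 2 : ℝ) : ℂ) ∂gaussianMeasure = ∑ k ∈ I, c k * conj (c k) := by
  have h := integral_quadratic_gaussianPi (fun k l : I => c k * conj (c l))
  rw [← (measurePreserving_restrict_gaussianMeasure I).map_eq, integral_map (by fun_prop)
    (Measurable.aestronglyMeasurable (by fun_prop))] at h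
  rw [← Finset.sum_coe_sort I, ← h]
  congr with ω
  rw [← Complex.normSq_eq_norm_sq, ← Complex.mul_conj, ← Finset.sum_coe_sort I, map_sum,
    Finset.sum_mul_sum]
  refine Finset.sum_congr rfl fun k _ => Finset.sum_congr rfl fun l _ => ?_
  simp only [map_mul, Finset.restrict]
  ring

end WickForm

/-! ### Integrated squares of centred quadratic forms. -/

section QuadraticFunctional

variable {Ξ : Type*} [MeasurableSpace Ξ] {ν : Measure Ξ} [IsFiniteMeasure ν]
  {a : Ξ → ℕ → ℕ → ℂ}

/-- The increment is again a centred form, with the coefficients on the block `J × J` erased, so the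
same moment bound applies to it. -/
lemma wickForm_sub_of_subset {I J : Finset ℕ} (hJI : J ⊆ I) (A : ℕ → ℕ → ℂ) (ω : ℕ → ℂ) :
    wickForm I A ω - wickForm J A ω =
      wickForm I (fun k l => if k ∈ J ∧ l ∈ J then 0 else A k l) ω := by
  have h : wickForm J A ω = wickForm I (fun k l => if k ∈ J ∧ l ∈ J then A k l else 0) ω := by
    simp only [wickForm]
    congr 1
    · rw [← Finset.sum_subset hJI]
      · refine Finset.sum_congr rfl fun k hk => ?_
        rw [← Finset.sum_subset hJI]
        · exact Finset.sum_congr rfl fun l hl => by simp [hk, hl]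
        · intro l _ hl
          simp [hl]
      · intro k _ hk
        simp [hk]
    · rw [← Finset.sum_subset hJI]
      · exact Finset.sum_congr rfl fun l hl => by simp [hl]
      · intro k _ hk
        simp [hk]
  rw [h]
  simp only [wickForm]
  rw [sub_sub_sub_comm, ← Finset.sum_sub_distrib, ← Finset.sum_sub_distrib]
  congr 1
  · refine Finset.sum_congr rfl fun k _ => ?_
    rw [← Finset.sum_sub_distrib]
    refine Finset.sum_congr rfl fun l _ => ?_
    split_ifs <;> ring
  · refine Finset.sum_congr rfl fun k _ => ?_
    split_ifs <;> ring

/-- The functional `½ ∫ |∑_{k, l ≤ K} a_ξ(k, l) (ω_k ω̄_l - δ_{k l})|² dν(ξ)`. -/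
noncomputable def wickSquare (ν : Measure Ξ) (a : Ξ → ℕ → ℕ → ℂ) (K : ℕ) (ω : ℕ → ℂ) : ℝ :=
  (1 / 2) * ∫ ξ, ‖wickForm (Finset.range (K + 1)) (a ξ) ω‖ ^ 2 ∂ν

lemma measurable_uncurry_wickForm (ha : ∀ k l, Measurable fun ξ => a ξ k l) (I : Finset ℕ) :
    Measurable (fun p : (ℕ → ℂ) × Ξ => wickForm I (a p.2) p.1) := by
  have (k l : ℕ) : Measurable fun p : (ℕ → ℂ) × Ξ => a p.2 k l := (ha k l).comp measurable_snd
  unfold wickForm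
  fun_prop

lemma measurable_wickSquare (ha : ∀ k l, Measurable fun ξ => a ξ k l) (K : ℕ) :
    Measurable (wickSquare ν a K) := by
  have h := ((measurable_uncurry_wickForm ha (Finset.range (K + 1))).norm.pow_const 2)
  have := h.stronglyMeasurable.integral_prod_right' (ν := ν)
  exact this.measurable.const_mul _

/-- Moments of an integral over `ν` of a product of two fields with known moments. -/
lemma lintegral_lintegral_mul_pow_le {Ω : Type*} [MeasurableSpace Ω] {μ : Measure Ω} [SFinite μ]
    {n : ℕ} (hn : n ≠ 0) {f g : Ω × Ξ → ℝ≥0∞} (hf : Measurable f) (hg : Measurable g)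
    (F G : ℝ≥0∞) (hF : ∀ ξ, ∫⁻ ω, f (ω, ξ) ^ (2 * n) ∂μ ≤ F)
    (hG : ∀ ξ, ∫⁻ ω, g (ω, ξ) ^ (2 * n) ∂μ ≤ G) :
    ∫⁻ ω, (∫⁻ ξ, f (ω, ξ) * g (ω, ξ) ∂ν) ^ n ∂μ ≤
      ν Set.univ ^ n * (F ^ (1 / 2 : ℝ) * G ^ (1 / 2 : ℝ)) := by
  calc ∫⁻ ω, (∫⁻ ξ, f (ω, ξ) * g (ω, ξ) ∂ν) ^ n ∂μ
      ≤ ∫⁻ ω, ν Set.univ ^ (n - 1) * ∫⁻ ξ, (f (ω, ξ) * g (ω, ξ)) ^ n ∂ν ∂μ :=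
        -- Power mean in `ξ`; after Tonelli, Cauchy–Schwarz in `ω` separates the two fields.
        lintegral_mono fun ω => lintegral_pow_le_measure_univ_mul hn (by fun_prop)
    _ = ν Set.univ ^ (n - 1) * ∫⁻ ξ, ∫⁻ ω, (f (ω, ξ) * g (ω, ξ)) ^ n ∂μ ∂ν := by
        rw [lintegral_const_mul, lintegral_lintegral_swap]
        · exact Measurable.aemeasurable (by fun_prop)
        · exact Measurable.lintegral_prod_right' (f := fun p : Ω × Ξ => (f p * g p) ^ n)
            (by fun_prop)
    _ ≤ ν Set.univ ^ (n - 1) * ∫⁻ _, F ^ (1 / 2 : ℝ) * G ^ (1 / 2 : ℝ) ∂ν := by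
        gcongr with ξ
        have h := ENNReal.lintegral_mul_le_Lp_mul_Lq μ (p := 2) (q := 2)
          (by constructor <;> norm_num)
          (f := fun ω => f (ω, ξ) ^ n) (g := fun ω => g (ω, ξ) ^ n)
          (Measurable.aemeasurable (by fun_prop)) (Measurable.aemeasurable (by fun_prop))
        simp only [Pi.mul_apply, ← mul_pow, ENNReal.rpow_two, ← pow_mul, mul_comm n 2] at h
        refine h.trans ?_
        gcongr
        · exact hF ξ
        · exact hG ξ
    _ = _ := by
        rw [lintegral_const]
        rw [← pow_sub_one_mul hn (ν Set.univ)]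
        ring

lemma integrable_norm_wickForm_sq (ha : ∀ k l, Measurable fun ξ => a ξ k l) {M : ℝ}
    (hM : ∀ ξ k l, ‖a ξ k l‖ ≤ M) (I : Finset ℕ) (ω : ℕ → ℂ) :
    Integrable (fun ξ => ‖wickForm I (a ξ) ω‖ ^ 2) ν := by
  have hm : Measurable fun ξ => wickForm I (a ξ) ω :=
    by
    unfold wickForm
    fun_prop
  refine Integrable.of_bound (hm.norm.pow_const 2).aestronglyMeasurable
    ((∑ k ∈ I, ∑ l ∈ I, M * ‖ω k * conj (ω l)‖ + ∑ k ∈ I, M) ^ 2)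
    (Eventually.of_forall fun ξ => ?_)
  rw [norm_pow, norm_norm]
  gcongr
  refine (norm_sub_le _ _).trans (add_le_add ?_ (norm_sum_le_of_le _ fun k _ => hM ξ k k))
  refine norm_sum_le_of_le _ fun k _ => norm_sum_le_of_le _ fun l _ => ?_
  rw [norm_mul]
  gcongr
  exact hM ξ k l

lemma abs_norm_sq_sub_norm_sq_le (x y : ℂ) : |‖x‖ ^ 2 - ‖y‖ ^ 2| ≤ ‖x - y‖ * (‖x‖ + ‖y‖) := by
  rw [sq_sub_sq, abs_mul, abs_of_nonneg (by positivity : 0 ≤ ‖x‖ + ‖y‖), mul_comm]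
  gcongr
  exact abs_norm_sub_norm_le x y

lemma le_of_forall_sum_sum_le {b : ℕ → ℕ → ℝ≥0∞} {M : ℝ≥0∞}
    (h : ∀ I : Finset ℕ, ∑ k ∈ I, ∑ l ∈ I, b k l ≤ M) (k l : ℕ) : b k l ≤ M := by
  set I := Finset.range (k + l + 1)
  have h1 : b k l ≤ ∑ l' ∈ I, b k l' :=
    Finset.single_le_sum (f := fun l' => b k l') (fun _ _ => zero_le)
      (Finset.mem_range.2 (by omega))
  have h2 : ∑ l' ∈ I, b k l' ≤ ∑ k' ∈ I, ∑ l' ∈ I, b k' l' :=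
    Finset.single_le_sum (f := fun k' => ∑ l' ∈ I, b k' l') (fun _ _ => zero_le)
      (Finset.mem_range.2 (by omega))
  exact h1.trans (h2.trans (h I))

/-- If the coefficients are uniformly square-summable with uniformly small tails, the functionals
`wickSquare ν a K` form a Cauchy sequence in every `L^m`. -/
theorem isCauchyInAllLp_wickSquare (ha : ∀ k l, Measurable fun ξ => a ξ k l) {M : ℝ≥0∞}
    (hM : M ≠ ∞) (hbound : ∀ ξ (I : Finset ℕ), ∑ k ∈ I, ∑ l ∈ I, ‖a ξ k l‖ₑ ^ 2 ≤ M)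
    {δ : ℕ → ℝ≥0∞} (hδ : Tendsto δ atTop (𝓝 0))
    (htail : ∀ ξ L K, L ≤ K → ∑ k ∈ Finset.range (K + 1), ∑ l ∈ Finset.range (K + 1),
      (if k ∈ Finset.range (L + 1) ∧ l ∈ Finset.range (L + 1) then 0 else ‖a ξ k l‖ₑ ^ 2) ≤ δ L) :
    IsCauchyInAllLp gaussianMeasure (wickSquare ν a) := by
  -- A uniform bound on single coefficients makes the squared forms `ν`-integrable for each `ω`, so
  -- that a difference of integrals may be merged below.
  have hcoef : ∀ ξ k l, ‖a ξ k l‖ ≤ Real.sqrt M.toReal := by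
    intro ξ k l
    refine Real.le_sqrt_of_sq_le ?_
    have h := le_of_forall_sum_sum_le (hbound ξ) k l
    have := ENNReal.toReal_mono hM h
    rwa [ENNReal.toReal_pow, toReal_enorm] at this
  have hnorm : ∀ n : ℕ, n ≠ 0 → ∀ K ξ,
      ∫⁻ ω, ‖wickForm (Finset.range (K + 1)) (a ξ) ω‖ₑ ^ (2 * n) ∂gaussianMeasure ≤
        chaosMomentConst n * M ^ n := fun n hn K ξ =>
    (lintegral_wickForm_pow_le hn _ _).trans (by gcongr; exact hbound ξ _)
  have hmeas := fun K => measurable_uncurry_wickForm ha (Finset.range (K + 1))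
  refine isCauchyInAllLp_of_moments
    (fun K => (measurable_wickSquare ha K).aestronglyMeasurable) (fun n hn K => ?_)
    (fun n hn => ?_)
  · have h := lintegral_lintegral_mul_pow_le (ν := ν) hn (hmeas K).enorm (hmeas K).enorm _ _
      (hnorm n hn K) (hnorm n hn K)
    refine lt_of_le_of_lt ?_ (h.trans_lt ?_)
    · refine lintegral_mono fun ω => pow_le_pow_left' ?_ n
      rw [wickSquare, enorm_mul]
      refine (mul_le_of_le_one_left zero_le ?_).trans
        ((enorm_integral_le_lintegral_enorm _).trans (le_of_eq ?_))
      · rw [← ofReal_norm]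
        norm_num
      · simp [pow_two]
    · have := chaosMomentConst_ne_top n
      refine ENNReal.mul_lt_top (by finiteness) (ENNReal.mul_lt_top ?_ ?_) <;>
        exact ENNReal.rpow_lt_top_of_nonneg (by norm_num) (by finiteness)
  · set C := chaosMomentConst n
    have hC : C ≠ ∞ := chaosMomentConst_ne_top n
    -- Moment bound for `|Q_K| + |Q_L|` by Minkowski. It pairs with the small moment of `Q_K - Q_L`
    -- through `||x|² - |y|²| ≤ |x - y| (|x| + |y|)`.
    set G := C * M ^ n * 2 ^ (2 * n) with hG
    have hGtop : G ^ (1 / 2 : ℝ) ≠ ∞ :=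
      (ENNReal.rpow_lt_top_of_nonneg (by norm_num) (by finiteness)).ne
    refine ⟨fun L => ν Set.univ ^ n * ((C * δ L ^ n) ^ (1 / 2 : ℝ) * G ^ (1 / 2 : ℝ)), ?_, ?_⟩
    · have h1 : Tendsto (fun L => C * δ L ^ n) atTop (𝓝 0) := by
        have := ENNReal.Tendsto.const_mul
          (((ENNReal.continuous_pow n).tendsto 0).comp hδ) (Or.inr hC)
        simpa [hn, Function.comp_def] using this
      have h2 : Tendsto (fun L => (C * δ L ^ n) ^ (1 / 2 : ℝ)) atTop (𝓝 0) := by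
        have := (ENNReal.continuous_rpow_const (y := 1 / 2)).tendsto 0 |>.comp h1
        simpa [ENNReal.zero_rpow_of_pos, Function.comp_def] using this
      have h3 := ENNReal.Tendsto.const_mul (ENNReal.Tendsto.mul_const h2 (Or.inr hGtop))
        (Or.inr (by finiteness : ν Set.univ ^ n ≠ ∞))
      simpa using h3
    · intro L K hLK
      have hsub : Finset.range (L + 1) ⊆ Finset.range (K + 1) := by
        simpa using hLK
      have h := lintegral_lintegral_mul_pow_le (ν := ν) (μ := gaussianMeasure) hn
        (f := fun p => ‖wickForm (Finset.range (K + 1)) (a p.2) p.1 -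
          wickForm (Finset.range (L + 1)) (a p.2) p.1‖ₑ)
        (g := fun p => ‖wickForm (Finset.range (K + 1)) (a p.2) p.1‖ₑ +
          ‖wickForm (Finset.range (L + 1)) (a p.2) p.1‖ₑ)
        ((hmeas K).sub (hmeas L)).enorm ((hmeas K).enorm.add (hmeas L).enorm)
        (C * δ L ^ n) G ?_ ?_
      · refine le_trans (lintegral_mono fun ω => pow_le_pow_left' ?_ n) h
        rw [wickSquare, wickSquare, ← mul_sub, ← integral_sub
          (integrable_norm_wickForm_sq ha hcoef _ _) (integrable_norm_wickForm_sq ha hcoef _ _),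
          enorm_mul]
        refine (mul_le_of_le_one_left zero_le ?_).trans
          ((enorm_integral_le_lintegral_enorm _).trans (lintegral_mono fun ξ => ?_))
        · rw [← ofReal_norm]
          norm_num
        · rw [← ofReal_norm, ← ofReal_norm, ← ofReal_norm, ← ofReal_norm,
            ← ENNReal.ofReal_add (norm_nonneg _) (norm_nonneg _),
            ← ENNReal.ofReal_mul (norm_nonneg _)]
          exact ENNReal.ofReal_le_ofReal (abs_norm_sq_sub_norm_sq_le _ _)
      · intro ξ
        simp only [wickForm_sub_of_subset hsub]
        refine (lintegral_wickForm_pow_le hn _ _).trans ?_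
        gcongr
        refine le_trans (le_of_eq ?_) (htail ξ L K hLK)
        refine Finset.sum_congr rfl fun k _ => Finset.sum_congr rfl fun l _ => ?_
        split_ifs <;> simp
      · intro ξ
        have h := lintegral_sum_pow_le (ν := gaussianMeasure) Finset.univ
          (by omega : 2 * n ≠ 0)
          (f := fun b : Bool => fun ω => ‖wickForm (Finset.range ((if b then K else L) + 1))
            (a ξ) ω‖ₑ) (fun b => Measurable.aemeasurable (by fun_prop)) (C * M ^ n) (fun _ => 1)
          (fun b => by rw [one_pow, mul_one]; exact hnorm n hn _ ξ)
        simpa [hG] using h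

end QuadraticFunctional

/-! ### Schur test for doubly substochastic arrays. -/

section Schur

/-- A Schur-type bound for a doubly substochastic array. -/
lemma sum_sum_mul_mul_le_sqrt_mul_sqrt {p : ℕ → ℕ → ℝ} (hp : ∀ k l, 0 ≤ p k l)
    (hrow : ∀ k (T : Finset ℕ), ∑ l ∈ T, p k l ≤ 1)
    (hcol : ∀ l (S : Finset ℕ), ∑ k ∈ S, p k l ≤ 1) (b : ℕ → ℝ) (S T : Finset ℕ) :
    ∑ k ∈ S, ∑ l ∈ T, p k l * (b k * b l) ≤
      Real.sqrt (∑ k ∈ S, b k ^ 2) * Real.sqrt (∑ l ∈ T, b l ^ 2) := by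
  -- Cauchy–Schwarz on the product set, with `√p` given to each factor: row sums control one square,
  -- column sums the other.
  have h := Real.sum_mul_le_sqrt_mul_sqrt (S ×ˢ T)
    (fun q => Real.sqrt (p q.1 q.2) * b q.1) (fun q => Real.sqrt (p q.1 q.2) * b q.2)
  have h1 : ∑ k ∈ S, ∑ l ∈ T, p k l * (b k * b l) = ∑ q ∈ S ×ˢ T,
      (Real.sqrt (p q.1 q.2) * b q.1) * (Real.sqrt (p q.1 q.2) * b q.2) := by
    rw [Finset.sum_product]
    refine Finset.sum_congr rfl fun k _ => Finset.sum_congr rfl fun l _ => ?_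
    linear_combination (-(b k * b l)) * Real.mul_self_sqrt (hp k l)
  rw [h1]
  refine h.trans ?_
  simp_rw [mul_pow, Real.sq_sqrt (hp _ _)]
  gcongr
  · rw [Finset.sum_product]
    refine Finset.sum_le_sum fun k _ => ?_
    dsimp only
    rw [← Finset.sum_mul]
    exact mul_le_of_le_one_left (sq_nonneg _) (hrow k T)
  · rw [Finset.sum_product_right]
    refine Finset.sum_le_sum fun l _ => ?_
    dsimp only
    rw [← Finset.sum_mul]
    exact mul_le_of_le_one_left (sq_nonneg _) (hcol l S)

/-- The complement of `J × J` in `I × I` is covered by `(I \ J) × I` and `I × (I \ J)`. On each, one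
variable lies in the tail and the Schur bound yields one small factor. -/
lemma sum_sum_off_block_le {p : ℕ → ℕ → ℝ} (hp : ∀ k l, 0 ≤ p k l)
    (hrow : ∀ k (T : Finset ℕ), ∑ l ∈ T, p k l ≤ 1)
    (hcol : ∀ l (S : Finset ℕ), ∑ k ∈ S, p k l ≤ 1) {b : ℕ → ℝ} (hb : ∀ k, 0 ≤ b k)
    (hsum : Summable fun k => b k ^ 2) {L K : ℕ} (hLK : L ≤ K) :
    ∑ k ∈ Finset.range (K + 1), ∑ l ∈ Finset.range (K + 1),
      (if k ∈ Finset.range (L + 1) ∧ l ∈ Finset.range (L + 1) then 0 else p k l * (b k * b l)) ≤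
      2 * (Real.sqrt (∑' k, b (k + (L + 1)) ^ 2) * Real.sqrt (∑' k, b k ^ 2)) := by
  set I := Finset.range (K + 1)
  set J := Finset.range (L + 1)
  have hJI : J ⊆ I := by simpa [I, J] using hLK
  have hI : ∑ k ∈ I, b k ^ 2 ≤ ∑' k, b k ^ 2 := hsum.sum_le_tsum _ fun _ _ => sq_nonneg _
  have hD : ∑ k ∈ I \ J, b k ^ 2 ≤ ∑' k, b (k + (L + 1)) ^ 2 := by
    have : I \ J = Finset.Ico (L + 1) (K + 1) := by
      ext k
      simp [I, J]
      omega
    rw [this, Finset.sum_Ico_eq_sum_range]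
    simp_rw [add_comm (L + 1)]
    exact ((summable_nat_add_iff (f := fun k => b k ^ 2) (L + 1)).2 hsum).sum_le_tsum _
      fun _ _ => sq_nonneg _
  have hx : ∀ k l, 0 ≤ p k l * (b k * b l) := fun k l =>
    mul_nonneg (hp k l) (mul_nonneg (hb k) (hb l))
  have h1 := (sum_sum_mul_mul_le_sqrt_mul_sqrt hp hrow hcol b (I \ J) I).trans
    (mul_le_mul (Real.sqrt_le_sqrt hD) (Real.sqrt_le_sqrt hI) (Real.sqrt_nonneg _)
      (Real.sqrt_nonneg _))
  have h2 := (sum_sum_mul_mul_le_sqrt_mul_sqrt hp hrow hcol b I (I \ J)).trans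
    (mul_le_mul (Real.sqrt_le_sqrt hI) (Real.sqrt_le_sqrt hD) (Real.sqrt_nonneg _)
      (Real.sqrt_nonneg _))
  rw [two_mul]
  nth_rewrite 2 [mul_comm (Real.sqrt (∑' k, b (k + (L + 1)) ^ 2))]
  refine le_trans ?_ (add_le_add h1 h2)
  have e1 : ∑ k ∈ I \ J, ∑ l ∈ I, p k l * (b k * b l) =
      ∑ k ∈ I, ∑ l ∈ I, if k ∉ J then p k l * (b k * b l) else 0 := by
    rw [Finset.sdiff_eq_filter, Finset.sum_filter]
    refine Finset.sum_congr rfl fun k _ => ?_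
    split_ifs <;> simp
  have e2 : ∑ k ∈ I, ∑ l ∈ I \ J, p k l * (b k * b l) =
      ∑ k ∈ I, ∑ l ∈ I, if l ∉ J then p k l * (b k * b l) else 0 := by
    refine Finset.sum_congr rfl fun k _ => ?_
    rw [Finset.sdiff_eq_filter, Finset.sum_filter]
  rw [e1, e2, ← Finset.sum_add_distrib]
  refine Finset.sum_le_sum fun k _ => ?_
  rw [← Finset.sum_add_distrib]
  refine Finset.sum_le_sum fun l _ => ?_
  have := hx k l
  by_cases hk : k ∈ J <;> by_cases hl : l ∈ J <;> simp [hk, hl, this]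

end Schur

/-! ### The truncated field and its matrix coefficients. -/

section Field

variable {Λ : Type} [MeasureSpace Λ] {u : HilbertBasis ℕ ℂ (L2 Λ)} {lam : ℕ → ℝ}

lemma integrable_mul_conj_L2 (f g : L2 Λ) : Integrable (fun x => f x * conj (g x)) :=
  (Lp.memLp f).integrable_mul (Lp.memLp g).star

/-- Bessel's inequality for the matrix elements of a multiplication operator bounded by one. -/
lemma sum_norm_sq_integral_mul_conj_le (u : HilbertBasis ℕ ℂ (L2 Λ)) {g : Λ → ℂ}
    (hg : Measurable g) (hg1 : ∀ x, ‖g x‖ ≤ 1) (k : ℕ) (T : Finset ℕ) :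
    ∑ l ∈ T, ‖∫ x, g x * (u k x * conj (u l x))‖ ^ 2 ≤ 1 := by
  have hmem : MemLp (fun x => g x * u k x) 2 :=
    (Lp.memLp (u k)).of_le (hg.aestronglyMeasurable.mul (Lp.aestronglyMeasurable _))
      (Eventually.of_forall fun x => by
        rw [norm_mul]
        exact mul_le_of_le_one_left (norm_nonneg _) (hg1 x))
  have hnorm : ‖hmem.toLp‖ ≤ 1 := by
    rw [← u.orthonormal.1 k]
    refine Lp.norm_le_norm_of_ae_le ?_
    filter_upwards [hmem.coeFn_toLp] with x hx
    rw [hx, norm_mul]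
    exact mul_le_of_le_one_left (norm_nonneg _) (hg1 x)
  -- The integrals are the coefficients of `g u_k` along the `u_l`, and this vector has norm at most
  -- one.
  have h := u.orthonormal.sum_inner_products_le hmem.toLp (s := T)
  refine le_trans (le_of_eq ?_) (h.trans (pow_le_one₀ (norm_nonneg _) hnorm))
  refine Finset.sum_congr rfl fun l _ => ?_
  congr 2
  rw [L2.inner_def]
  refine integral_congr_ae ?_
  filter_upwards [hmem.coeFn_toLp] with x hx
  rw [hx, RCLike.inner_apply]
  ring

/-- Conjugation exchanges the two indices and replaces `g` by its conjugate, so the row bound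
becomes the column bound. -/
lemma sum_norm_sq_integral_mul_conj_le' (u : HilbertBasis ℕ ℂ (L2 Λ)) {g : Λ → ℂ}
    (hg : Measurable g) (hg1 : ∀ x, ‖g x‖ ≤ 1) (l : ℕ) (S : Finset ℕ) :
    ∑ k ∈ S, ‖∫ x, g x * (u k x * conj (u l x))‖ ^ 2 ≤ 1 := by
  refine le_trans (le_of_eq ?_) (sum_norm_sq_integral_mul_conj_le u (g := fun x => conj (g x))
    (Complex.continuous_conj.measurable.comp hg) (fun x => by simpa using hg1 x) l S)
  refine Finset.sum_congr rfl fun k _ => ?_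
  rw [← RCLike.norm_conj, ← integral_conj]
  congr 3 with x
  simp only [map_mul, Complex.conj_conj]
  ring

/-- The mode `u_k(x) / √(lam k)`. -/
noncomputable def mode (lam : ℕ → ℝ) (u : HilbertBasis ℕ ℂ (L2 Λ)) (k : ℕ) (x : Λ) : ℂ :=
  u k x / (Real.sqrt (lam k) : ℂ)

lemma integrable_mode_mul_conj (lam : ℕ → ℝ) (u : HilbertBasis ℕ ℂ (L2 Λ)) (k l : ℕ) :
    Integrable (fun x => mode lam u k x * conj (mode lam u l x)) := by
  have h := (integrable_mul_conj_L2 (u k) (u l)).mul_const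
    (((Real.sqrt (lam k) : ℂ))⁻¹ * ((Real.sqrt (lam l) : ℂ))⁻¹)
  refine h.congr (Eventually.of_forall fun x => ?_)
  simp only [mode, div_eq_mul_inv, map_mul, map_inv₀, Complex.conj_ofReal]
  ring

lemma truncField_eq_sum_mode (K : ℕ) (ω : ℕ → ℂ) (x : Λ) :
    truncField lam u K ω x = ∑ k ∈ Finset.range (K + 1), mode lam u k x * ω k :=
  Finset.sum_congr rfl fun k _ => by rw [mode]; ring

/-- The centred density `|φ_[K](x)|² - ϱ_[K](x)` is a centred quadratic form. -/
lemma norm_sq_truncField_sub_truncDensity (K : ℕ) (ω : ℕ → ℂ) (x : Λ) :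
    ((‖truncField lam u K ω x‖ ^ 2 - truncDensity lam u K x : ℝ) : ℂ) =
      wickForm (Finset.range (K + 1)) (fun k l => mode lam u k x * conj (mode lam u l x)) ω := by
  have h := integral_norm_sq_linear_gaussianMeasure (Finset.range (K + 1))
    (fun k => mode lam u k x)
  rw [integral_complex_ofReal] at h
  rw [Complex.ofReal_sub, truncDensity]
  simp_rw [truncField_eq_sum_mode]
  rw [h, wickForm]
  congr 1
  rw [← Complex.normSq_eq_norm_sq, ← Complex.mul_conj, map_sum, Finset.sum_mul_sum]
  refine Finset.sum_congr rfl fun k _ => Finset.sum_congr rfl fun l _ => ?_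
  simp only [map_mul]
  ring

variable {Ξ : Type*} [MeasurableSpace Ξ] {e : Ξ → Λ → ℂ}

/-- The matrix elements of `h^{-1/2} e_ξ h^{-1/2}` in the eigenbasis. -/
noncomputable def fieldCoeff (e : Ξ → Λ → ℂ) (lam : ℕ → ℝ) (u : HilbertBasis ℕ ℂ (L2 Λ))
    (ξ : Ξ) (k l : ℕ) : ℂ :=
  ∫ x, e ξ x * (mode lam u k x * conj (mode lam u l x))

lemma integral_mul_wickForm_mode (he : Measurable (Function.uncurry e))
    (he1 : ∀ ξ x, ‖e ξ x‖ = 1) (I : Finset ℕ) (ω : ℕ → ℂ) (ξ : Ξ) :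
    ∫ x, e ξ x * wickForm I (fun k l => mode lam u k x * conj (mode lam u l x)) ω =
      wickForm I (fieldCoeff e lam u ξ) ω := by
  have hint : ∀ k l, Integrable fun x => e ξ x * (mode lam u k x * conj (mode lam u l x)) :=
    fun k l => (integrable_mode_mul_conj lam u k l).bdd_mul
      (he.comp measurable_prodMk_left).aestronglyMeasurable
      (Eventually.of_forall fun x => (he1 ξ x).le)
  simp only [wickForm, fieldCoeff, mul_sub, Finset.mul_sum, ← mul_assoc]
  simp only [← mul_assoc] at hint
  rw [integral_sub, integral_finsetSum, integral_finsetSum]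
  · congr 1
    refine Finset.sum_congr rfl fun k _ => ?_
    rw [integral_finsetSum]
    · simp_rw [integral_mul_const]
    · exact fun l _ => ((hint k l).mul_const _).mul_const _
  · exact fun k _ => hint k k
  · exact fun k _ => integrable_finsetSum _ fun l _ => ((hint k l).mul_const _).mul_const _
  · exact integrable_finsetSum _ fun k _ => integrable_finsetSum _ fun l _ =>
      ((hint k l).mul_const _).mul_const _
  · exact integrable_finsetSum _ fun k _ => hint k k

lemma integrable_wickForm_mode (I : Finset ℕ) (ω : ℕ → ℂ) :
    Integrable fun x => wickForm I (fun k l => mode lam u k x * conj (mode lam u l x)) ω := by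
  unfold wickForm
  exact (integrable_finsetSum _ fun k _ => integrable_finsetSum _ fun l _ =>
    (integrable_mode_mul_conj lam u k l).mul_const _).sub
      (integrable_finsetSum _ fun k _ => integrable_mode_mul_conj lam u k k)

variable [SigmaFinite (volume : Measure Λ)]

lemma measurable_fieldCoeff (he : Measurable (Function.uncurry e)) (k l : ℕ) :
    Measurable fun ξ => fieldCoeff e lam u ξ k l := by
  have hu : ∀ k, Measurable (mode lam u k) := fun k =>
    (Lp.stronglyMeasurable (u k)).measurable.div_const _
  have h : Measurable fun p : Ξ × Λ =>
      e p.1 p.2 * (mode lam u k p.2 * conj (mode lam u l p.2)) :=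
    he.mul (((hu k).comp measurable_snd).mul
      (Complex.continuous_conj.measurable.comp ((hu l).comp measurable_snd)))
  exact (h.stronglyMeasurable.integral_prod_right' (ν := volume)).measurable

/-- The centred density `N` is real, so for fixed `ξ` the double integral factors as `∫ e_ξ N` times
its own conjugate. -/
lemma truncInteraction_eq_wickSquare [AddCommGroup Λ] {ν : Measure Ξ} [IsFiniteMeasure ν]
    (he : Measurable (Function.uncurry e)) (he1 : ∀ ξ x, ‖e ξ x‖ = 1) {w : Λ → ℝ}
    (hw : ∀ᵐ p : Λ × Λ, (w (p.1 - p.2) : ℂ) = ∫ ξ, e ξ p.1 * conj (e ξ p.2) ∂ν) :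
    truncInteraction lam u w = wickSquare ν (fieldCoeff e lam u) := by
  ext K ω
  set I := Finset.range (K + 1)
  set N : Λ → ℂ := fun x =>
    wickForm I (fun k l => mode lam u k x * conj (mode lam u l x)) ω with hN
  have hNreal : ∀ x, ((‖truncField lam u K ω x‖ ^ 2 - truncDensity lam u K x : ℝ) : ℂ) = N x :=
    fun x => norm_sq_truncField_sub_truncDensity K ω x
  have hNconj : ∀ x, conj (N x) = N x := fun x => by rw [← hNreal, Complex.conj_ofReal]
  have hNint : Integrable N := integrable_wickForm_mode I ω
  rw [truncInteraction, wickSquare]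
  congr 1
  apply Complex.ofReal_injective
  rw [← integral_complex_ofReal, ← integral_complex_ofReal]
  -- Fubini is legitimate because the integrand has modulus `|N(x) N(y)|`, with `N` integrable and
  -- `ν` finite.
  have hint : Integrable (Function.uncurry fun (p : Λ × Λ) (ξ : Ξ) =>
      (e ξ p.1 * N p.1) * conj (e ξ p.2 * N p.2)) (volume.prod ν) := by
    have h1 : Integrable (fun p : Λ × Λ => N p.1 * N p.2) := hNint.mul_prod hNint
    have h2 := (h1.comp_fst ν).bdd_mul (c := 1)
      (f := fun q : (Λ × Λ) × Ξ => e q.2 q.1.1 * conj (e q.2 q.1.2)) ?_ ?_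
    · refine h2.congr (Eventually.of_forall fun q => ?_)
      simp only [Function.uncurry, map_mul, hNconj]
      ring
    · exact Measurable.aestronglyMeasurable
        ((he.comp (measurable_snd.prodMk (measurable_fst.comp measurable_fst))).mul
        (Complex.continuous_conj.measurable.comp
          (he.comp (measurable_snd.prodMk (measurable_snd.comp measurable_fst)))))
    · refine Eventually.of_forall fun q => ?_
      simp [he1]
  calc ∫ p : Λ × Λ, (((‖truncField lam u K ω p.1‖ ^ 2 - truncDensity lam u K p.1) *
        w (p.1 - p.2) * (‖truncField lam u K ω p.2‖ ^ 2 - truncDensity lam u K p.2) : ℝ) : ℂ)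
      = ∫ p : Λ × Λ, ∫ ξ, (e ξ p.1 * N p.1) * conj (e ξ p.2 * N p.2) ∂ν := by
        refine integral_congr_ae ?_
        filter_upwards [hw] with p hp
        rw [Complex.ofReal_mul, Complex.ofReal_mul, hNreal, hNreal, hp]
        rw [mul_comm (N p.1), mul_assoc, ← integral_mul_const]
        congr with ξ
        rw [map_mul, hNconj]
        ring
    _ = ∫ ξ, (∫ p : Λ × Λ, (e ξ p.1 * N p.1) * conj (e ξ p.2 * N p.2)) ∂ν :=
        integral_integral_swap hint
    _ = _ := by
        congr with ξ
        have h := integral_prod_mul (μ := (volume : Measure Λ)) (ν := (volume : Measure Λ))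
          (fun x => e ξ x * N x) (fun x => conj (e ξ x * N x))
        rw [integral_conj, integral_mul_wickForm_mode he he1 I ω ξ, Complex.mul_conj,
          Complex.normSq_eq_norm_sq] at h
        exact h

/-- The convergence theorem for interactions `w(x - y) = ∫ e_ξ(x) conj (e_ξ(y)) dν(ξ)` with a
finite measure `ν` and unimodular `e_ξ`. -/
theorem truncInteraction_converges [AddCommGroup Λ] {ν : Measure Ξ} [IsFiniteMeasure ν]
    (he : Measurable (Function.uncurry e)) (he1 : ∀ ξ x, ‖e ξ x‖ = 1)
    (hlam : ∀ k, 0 < lam k) (hsum : Summable fun k => (lam k)⁻¹ ^ 2) {w : Λ → ℝ}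
    (hw : ∀ᵐ p : Λ × Λ, (w (p.1 - p.2) : ℂ) = ∫ ξ, e ξ p.1 * conj (e ξ p.2) ∂ν) :
    IsCauchyInAllLp gaussianMeasure (truncInteraction lam u w) ∧
      ∃ W : (ℕ → ℂ) → ℝ, IsLimitInAllLp gaussianMeasure (truncInteraction lam u w) W ∧
        ∀ W' : (ℕ → ℂ) → ℝ, IsLimitInAllLp gaussianMeasure (truncInteraction lam u w) W' →
          W' =ᵐ[gaussianMeasure] W := by
  rw [truncInteraction_eq_wickSquare he he1 hw]
  have ha := fun k l => measurable_fieldCoeff (lam := lam) (u := u) he k l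
  have hX : ∀ K, AEStronglyMeasurable (wickSquare ν (fieldCoeff e lam u) K) gaussianMeasure :=
    fun K => (measurable_wickSquare ha K).aestronglyMeasurable
  have hcauchy : IsCauchyInAllLp gaussianMeasure (wickSquare ν (fieldCoeff e lam u)) := by
    set p : Ξ → ℕ → ℕ → ℝ := fun ξ k l => ‖∫ x, e ξ x * (u k x * conj (u l x))‖ ^ 2 with hp
    have hem : ∀ ξ, Measurable (e ξ) := fun ξ => he.comp measurable_prodMk_left
    have hp0 : ∀ ξ k l, 0 ≤ p ξ k l := fun ξ k l => sq_nonneg _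
    have hrow := fun ξ => sum_norm_sq_integral_mul_conj_le u (hem ξ) fun x => (he1 ξ x).le
    have hcol := fun ξ => sum_norm_sq_integral_mul_conj_le' u (hem ξ) fun x => (he1 ξ x).le
    have hb : ∀ k, 0 ≤ (lam k)⁻¹ := fun k => (inv_pos.2 (hlam k)).le
    have hcoef : ∀ ξ k l, ‖fieldCoeff e lam u ξ k l‖ₑ ^ 2 =
        ENNReal.ofReal (p ξ k l * ((lam k)⁻¹ * (lam l)⁻¹)) := by
      intro ξ k l
      rw [← ofReal_norm, ← ENNReal.ofReal_pow (norm_nonneg _)]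
      congr 1
      have : fieldCoeff e lam u ξ k l = (∫ x, e ξ x * (u k x * conj (u l x))) *
          ((Real.sqrt (lam k) : ℂ)⁻¹ * (Real.sqrt (lam l) : ℂ)⁻¹) := by
        rw [fieldCoeff, ← integral_mul_const]
        congr with x
        simp only [mode, div_eq_mul_inv, map_mul, map_inv₀, Complex.conj_ofReal]
        ring
      rw [this, norm_mul, mul_pow]
      congr 1
      simp [mul_pow, (hlam _).le]
    have hsum_eq : ∀ ξ (I : Finset ℕ), ∑ k ∈ I, ∑ l ∈ I, ‖fieldCoeff e lam u ξ k l‖ₑ ^ 2 =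
        ENNReal.ofReal (∑ k ∈ I, ∑ l ∈ I, p ξ k l * ((lam k)⁻¹ * (lam l)⁻¹)) := by
      intro ξ I
      have h0 : ∀ k l, 0 ≤ p ξ k l * ((lam k)⁻¹ * (lam l)⁻¹) := fun k l =>
        mul_nonneg (hp0 ξ k l) (mul_nonneg (hb k) (hb l))
      rw [ENNReal.ofReal_sum_of_nonneg fun k _ => Finset.sum_nonneg fun l _ => h0 k l]
      refine Finset.sum_congr rfl fun k _ => ?_
      rw [ENNReal.ofReal_sum_of_nonneg fun l _ => h0 k l]
      exact Finset.sum_congr rfl fun l _ => hcoef ξ k l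
    refine isCauchyInAllLp_wickSquare ha (M := ENNReal.ofReal (∑' k, (lam k)⁻¹ ^ 2))
      ENNReal.ofReal_ne_top ?_
      -- The truncation at `L` keeps the index `L`, so the tail starts at `L + 1`.
      (δ := fun L => ENNReal.ofReal (2 * (Real.sqrt (∑' k, (lam (k + (L + 1)))⁻¹ ^ 2) *
        Real.sqrt (∑' k, (lam k)⁻¹ ^ 2)))) ?_ ?_
    · intro ξ I
      rw [hsum_eq]
      refine ENNReal.ofReal_le_ofReal ?_
      refine (sum_sum_mul_mul_le_sqrt_mul_sqrt (hp0 ξ) (hrow ξ) (hcol ξ)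
        (fun k => (lam k)⁻¹) I I).trans ?_
      rw [Real.mul_self_sqrt (Finset.sum_nonneg fun _ _ => sq_nonneg _)]
      exact hsum.sum_le_tsum _ fun _ _ => sq_nonneg _
    · have h1 := (tendsto_sum_nat_add fun k => (lam k)⁻¹ ^ 2).comp (tendsto_add_atTop_nat 1)
      have h2 := ((h1.sqrt.mul_const (Real.sqrt (∑' k, (lam k)⁻¹ ^ 2))).const_mul 2)
      have h3 := ENNReal.tendsto_ofReal h2
      simpa using h3
    · intro ξ L K hLK
      have h := sum_sum_off_block_le (hp0 ξ) (hrow ξ) (hcol ξ) hb hsum hLK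
      refine le_trans (le_of_eq ?_) (ENNReal.ofReal_le_ofReal h)
      have h0 : ∀ k l, 0 ≤ (if k ∈ Finset.range (L + 1) ∧ l ∈ Finset.range (L + 1) then 0 else
          p ξ k l * ((lam k)⁻¹ * (lam l)⁻¹)) := fun k l => by
        split_ifs
        exacts [le_rfl, mul_nonneg (hp0 ξ k l) (mul_nonneg (hb k) (hb l))]
      rw [ENNReal.ofReal_sum_of_nonneg fun k _ => Finset.sum_nonneg fun l _ => h0 k l]
      refine Finset.sum_congr rfl fun k _ => ?_
      rw [ENNReal.ofReal_sum_of_nonneg fun l _ => h0 k l]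
      refine Finset.sum_congr rfl fun l _ => ?_
      split_ifs
      · simp
      · exact hcoef ξ k l
  obtain ⟨W, hW⟩ := hcauchy.exists_limit hX
  exact ⟨hcauchy, W, hW, fun W' hW' => hW.ae_eq hX hW'⟩

end Field

/-! ### Lower bound on the spectrum and the trace condition. -/

section Spectrum

variable {Λ : Type} [AddCommGroup Λ] [TopologicalSpace Λ] [MeasureSpace Λ] {d : ℕ}
  {π : Eucl d → Λ} {κ : ℝ} {v : Λ → ℝ} {lam : ℕ → ℝ} {u : HilbertBasis ℕ ℂ (L2 Λ)}

/-- Testing the weak eigenvalue equation against `u k` itself gives `lam k = ∫ |∇u_k|² + κ + ∫ v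
|u_k|²`. -/
lemma IsSpectralDecomposition.le_eigenvalue (h : IsSpectralDecomposition π κ v lam u)
    (hv : ∀ x, 0 ≤ v x) (k : ℕ) : κ ≤ lam k := by
  obtain ⟨F, hF, hform⟩ := h k
  have hq := hform (u k) F hF
  have hnorm : ⟪u k, u k⟫_ℂ = 1 := by
    rw [inner_self_eq_norm_sq_to_K, u.orthonormal.1 k]
    simp
  have hmass : ∫ x, ‖u k x‖ ^ 2 = 1 := by
    rw [L2.inner_def] at hnorm
    simp_rw [inner_self_eq_norm_sq_to_K] at hnorm
    apply Complex.ofReal_injective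
    rw [← integral_complex_ofReal, Complex.ofReal_one, ← hnorm]
    simp
  have hmassint : Integrable fun x => ‖u k x‖ ^ 2 := (Lp.memLp (u k)).integrable_norm_pow (by simp)
  have hpot : ∫ x, ((κ + v x : ℝ) : ℂ) * (star (u k x) * u k x) =
      ((κ + ∫ x, v x * ‖u k x‖ ^ 2 : ℝ) : ℂ) := by
    have : ∀ x, ((κ + v x : ℝ) : ℂ) * (star (u k x) * u k x) =
        ((κ * ‖u k x‖ ^ 2 + v x * ‖u k x‖ ^ 2 : ℝ) : ℂ) := fun x => by
      rw [← add_mul, Complex.ofReal_mul]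
      congr 1
      rw [mul_comm, ← Complex.normSq_eq_norm_sq, ← Complex.mul_conj]
      rfl
    simp_rw [this]
    rw [integral_complex_ofReal, integral_add (hmassint.const_mul κ) hF.2, integral_const_mul,
      hmass, mul_one]
  rw [hpot, inner_smul_right, hnorm, mul_one] at hq
  have hre := congrArg Complex.re hq
  rw [Complex.add_re, Complex.ofReal_re, Complex.ofReal_re, Complex.re_sum] at hre
  have h1 : 0 ≤ ∑ j, (⟪F j, F j⟫_ℂ).re := Finset.sum_nonneg fun j _ => inner_self_nonneg (𝕜 := ℂ)
  have h2 : 0 ≤ ∫ x, v x * ‖u k x‖ ^ 2 := integral_nonneg fun x => mul_nonneg (hv x) (sq_nonneg _)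
  linarith

/-- Split `λ⁻² = λ^(s-1) λ^(-1-s)`; the last exponent is nonpositive, so that factor is at most
`κ^(-1-s)`. -/
lemma summable_inv_sq_of_tracePow (hκ : 0 < κ) (hlam : ∀ k, κ ≤ lam k) {s : ℝ} (hs : -1 ≤ s)
    (htr : tracePow lam (s - 1) < ∞) : Summable fun k => (lam k)⁻¹ ^ 2 := by
  have hpos : ∀ k, 0 < lam k := fun k => hκ.trans_le (hlam k)
  have h1 : Summable fun k => lam k ^ (s - 1) := by
    have h := ENNReal.summable_toReal htr.ne
    refine h.congr fun k => ?_
    rw [ENNReal.toReal_ofReal (Real.rpow_nonneg (hpos k).le _)]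
  refine Summable.of_nonneg_of_le (fun _ => sq_nonneg _) (fun k => ?_)
    (h1.mul_right (κ ^ (-1 - s)))
  have h2 : (lam k)⁻¹ ^ 2 = lam k ^ (s - 1) * lam k ^ (-1 - s) := by
    rw [← Real.rpow_add (hpos k), show s - 1 + (-1 - s) = -2 by ring, Real.rpow_neg (hpos k).le,
      inv_pow]
    norm_num
  rw [h2]
  refine mul_le_mul_of_nonneg_left ?_ (Real.rpow_nonneg (hpos k).le _)
  exact Real.rpow_le_rpow_of_nonpos hκ (hlam k) (by linarith)

end Spectrum

/-! ### Bochner-type representation on `ℝ^d`. -/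

section Euclidean

variable {d : ℕ}

/-- Dilation acts on the Fourier side by the `L¹`-preserving rescaling `R^d F(R x)`. -/
lemma integral_norm_fourier_comp_inv_smul (f : Eucl d → ℂ) {R : ℝ} (hR : 0 < R) :
    ∫ x, ‖𝓕 (fun ξ => f (R⁻¹ • ξ)) x‖ = ∫ x, ‖𝓕 f x‖ := by
  have h : ∀ x, 𝓕 (fun ξ => f (R⁻¹ • ξ)) x = (R ^ d : ℝ) • 𝓕 f (R • x) := by
    intro x
    rw [Real.fourier_eq', Real.fourier_eq']
    have := Measure.integral_comp_inv_smul_of_nonneg (volume : Measure (Eucl d))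
      (fun η => Complex.exp ((↑(-2 * Real.pi * ⟪η, R • x⟫_ℝ) * Complex.I)) • f η) hR.le
    rw [finrank_euclideanSpace_fin] at this
    rw [← this]
    congr with ξ
    rw [inner_smul_left, inner_smul_right]
    simp [hR.ne']
  simp_rw [h, norm_smul]
  rw [integral_const_mul, Measure.integral_comp_smul_of_nonneg volume (fun y => ‖𝓕 f y‖) R
    (hR := hR.le), finrank_euclideanSpace_fin]
  simp [abs_of_pos hR, hR.ne']

/-- A bump dilated by `R` dominates the indicator of the ball of radius `R`, while its `ν`-integral
is at most `‖w‖_∞` times the `L¹` norm of its Fourier transform, which does not depend on `R`. Let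
`R → ∞`. -/
lemma isFiniteMeasure_of_fourier {w : Eucl d → ℝ} (hw : MemLp w ∞ volume)
    {ν : Measure (Eucl d)} (hν : ∀ f : 𝓢(Eucl d, ℂ),
      Integrable (fun ξ => f ξ) ν ∧ ∫ ξ, f ξ ∂ν = ∫ x, (w x : ℂ) * 𝓕 (fun ξ => f ξ) x) :
    IsFiniteMeasure ν := by
  let φ : ContDiffBump (0 : Eucl d) := ⟨1, 2, one_pos, one_lt_two⟩
  let f : Eucl d → ℂ := fun ξ => (φ ξ : ℂ)
  have hfsmooth : ContDiff ℝ (⊤ : ℕ∞) f := Complex.ofRealCLM.contDiff.comp φ.contDiff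
  have hfsupp : HasCompactSupport f := φ.hasCompactSupport.comp_left (g := Complex.ofReal) rfl
  set C := (eLpNorm w ∞ volume).toReal with hC
  have hwC : ∀ᵐ x, ‖w x‖ ≤ C := by
    filter_upwards [enorm_ae_le_eLpNormEssSup w volume] with x hx
    rw [← eLpNorm_exponent_top] at hx
    have := ENNReal.toReal_mono hw.2.ne hx
    rwa [toReal_enorm] at this
  set B := C * ∫ x, ‖𝓕 f x‖ with hB
  have hball : ∀ n : ℕ, ν (Metric.closedBall 0 (n + 1 : ℝ)) ≤ ENNReal.ofReal B := by
    intro n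
    set R : ℝ := n + 1 with hRdef
    have hR : 0 < R := by positivity
    have hcs : HasCompactSupport fun ξ => f (R⁻¹ • ξ) :=
      hfsupp.comp_homeomorph (Homeomorph.smulOfNeZero R⁻¹ (inv_ne_zero hR.ne'))
    have hcd : ContDiff ℝ (⊤ : ℕ∞) fun ξ => f (R⁻¹ • ξ) :=
      hfsmooth.comp (contDiff_const_smul R⁻¹)
    obtain ⟨hint, heq⟩ := hν (hcs.toSchwartzMap hcd)
    simp only [HasCompactSupport.toSchwartzMap_toFun] at hint heq
    have hFint : Integrable (𝓕 (fun ξ => f (R⁻¹ • ξ))) :=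
      (𝓕 (hcs.toSchwartzMap hcd)).integrable
    have hle : ∫ ξ, φ (R⁻¹ • ξ) ∂ν ≤ B := by
      have h1 : ((∫ ξ, φ (R⁻¹ • ξ) ∂ν : ℝ) : ℂ) = ∫ x, (w x : ℂ) * 𝓕 (fun ξ => f (R⁻¹ • ξ)) x := by
        rw [← heq, ← integral_complex_ofReal]
      calc ∫ ξ, φ (R⁻¹ • ξ) ∂ν ≤ ‖((∫ ξ, φ (R⁻¹ • ξ) ∂ν : ℝ) : ℂ)‖ := by
            rw [Complex.norm_real]; exact le_abs_self _
        _ ≤ ∫ x, C * ‖𝓕 (fun ξ => f (R⁻¹ • ξ)) x‖ := by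
            rw [h1]
            refine norm_integral_le_of_norm_le (hFint.norm.const_mul C) ?_
            filter_upwards [hwC] with x hx
            rw [norm_mul, Complex.norm_real]
            gcongr
        _ = B := by rw [integral_const_mul, integral_norm_fourier_comp_inv_smul f hR]
    have hintr : Integrable (fun ξ => φ (R⁻¹ • ξ)) ν := by
      have := hint.re
      simpa [f] using this
    calc ν (Metric.closedBall 0 R) = ∫⁻ ξ in Metric.closedBall 0 R, 1 ∂ν := by simp
      _ ≤ ∫⁻ ξ in Metric.closedBall 0 R, ENNReal.ofReal (φ (R⁻¹ • ξ)) ∂ν := by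
          refine setLIntegral_mono' Metric.isClosed_closedBall.measurableSet fun ξ hξ => ?_
          rw [φ.one_of_mem_closedBall, ENNReal.ofReal_one]
          rw [mem_closedBall_zero_iff] at hξ ⊢
          rw [norm_smul, norm_inv, Real.norm_of_nonneg hR.le]
          change R⁻¹ * ‖ξ‖ ≤ 1
          rw [inv_mul_le_iff₀ hR, mul_one]
          exact hξ
      _ ≤ ∫⁻ ξ, ENNReal.ofReal (φ (R⁻¹ • ξ)) ∂ν := setLIntegral_le_lintegral _ _
      _ = ENNReal.ofReal (∫ ξ, φ (R⁻¹ • ξ) ∂ν) :=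
          (ofReal_integral_eq_lintegral_ofReal hintr (Eventually.of_forall fun _ => φ.nonneg)).symm
      _ ≤ ENNReal.ofReal B := ENNReal.ofReal_le_ofReal hle
  constructor
  have hU : (⋃ n : ℕ, Metric.closedBall (0 : Eucl d) (n + 1 : ℝ)) = Set.univ := by
    refine Set.eq_univ_of_forall fun x => ?_
    obtain ⟨n, hn⟩ := exists_nat_ge ‖x‖
    exact Set.mem_iUnion.2 ⟨n, by rw [mem_closedBall_zero_iff]; linarith⟩
  have hmono : Monotone fun n : ℕ => Metric.closedBall (0 : Eucl d) (n + 1 : ℝ) := by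
    intro m n hmn
    refine Metric.closedBall_subset_closedBall ?_
    have : (m : ℝ) ≤ n := by exact_mod_cast hmn
    linarith
  rw [← hU, hmono.measure_iUnion]
  exact (iSup_le hball).trans_lt ENNReal.ofReal_lt_top

/-- The plane wave `exp (2 π i ⟨ξ, x⟩)`. -/
noncomputable def planeWave (ξ x : Eucl d) : ℂ :=
  Complex.exp ((2 * Real.pi * ⟪x, ξ⟫_ℝ : ℝ) * Complex.I)

lemma norm_planeWave (ξ x : Eucl d) : ‖planeWave ξ x‖ = 1 := Complex.norm_exp_ofReal_mul_I _

lemma continuous_planeWave : Continuous (Function.uncurry (planeWave (d := d))) := by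
  unfold planeWave Function.uncurry
  fun_prop

lemma planeWave_sub (ξ x y : Eucl d) :
    planeWave ξ (x - y) = planeWave ξ x * conj (planeWave ξ y) := by
  simp only [planeWave]
  rw [← Complex.exp_conj, ← Complex.exp_add, inner_sub_left]
  congr 1
  simp only [Complex.ofReal_mul, Complex.ofReal_sub, map_mul, Complex.conj_ofReal, Complex.conj_I]
  ring

/-- A bounded function of positive type is almost everywhere the Fourier transform of the finite
measure that represents it. -/
lemma ae_eq_integral_planeWave {w : Eucl d → ℝ} (hw : MemLp w ∞ volume)
    {ν : Measure (Eucl d)} [IsFiniteMeasure ν] (hν : ∀ f : 𝓢(Eucl d, ℂ),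
      Integrable (fun ξ => f ξ) ν ∧ ∫ ξ, f ξ ∂ν = ∫ x, (w x : ℂ) * 𝓕 (fun ξ => f ξ) x) :
    ∀ᵐ x, (w x : ℂ) = ∫ ξ, planeWave ξ x ∂ν := by
  have hloc : LocallyIntegrable fun x => (w x : ℂ) := hw.ofReal.locallyIntegrable (by simp)
  have hmeas : Measurable fun x : Eucl d => ∫ ξ, planeWave ξ x ∂ν :=
    ((continuous_planeWave.comp continuous_swap).measurable.stronglyMeasurable.integral_prod_right'
      (ν := ν)).measurable
  have hloc' : LocallyIntegrable fun x : Eucl d => ∫ ξ, planeWave ξ x ∂ν := by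
    refine MemLp.locallyIntegrable (p := ∞) (memLp_top_of_bound hmeas.aestronglyMeasurable
      (ν.real Set.univ) (Eventually.of_forall fun x => ?_)) (by simp)
    refine (norm_integral_le_integral_norm _).trans (le_of_eq ?_)
    simp [norm_planeWave]
  refine ae_eq_of_integral_contDiff_smul_eq hloc hloc' fun g hg hgs => ?_
  have hgs' : HasCompactSupport fun x => (g x : ℂ) := hgs.comp_left (g := Complex.ofReal) rfl
  set G : 𝓢(Eucl d, ℂ) := hgs'.toSchwartzMap (Complex.ofRealCLM.contDiff.comp hg) with hG
  have hGg : ∀ x, G x = g x := fun x => rfl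
  -- Testing on the inverse transform of `G` leaves `∫ w G` on one side; on the other, Fubini moves
  -- `ν` onto the plane waves.
  have h1 := (hν (𝓕⁻ G)).2
  have h2 : 𝓕 (fun ξ : Eucl d => (𝓕⁻ G : 𝓢(Eucl d, ℂ)) ξ) = fun x : Eucl d => G x := by
    funext x
    change (𝓕 (𝓕⁻ G)) x = G x
    rw [FourierTransform.fourier_fourierInv_eq]
  rw [h2] at h1
  have h3 : ∀ ξ, (𝓕⁻ G) ξ = ∫ x, G x * planeWave ξ x := by
    intro ξ
    rw [SchwartzMap.fourierInv_coe, Real.fourierInv_eq']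
    congr with x
    rw [planeWave, smul_eq_mul, mul_comm]
  simp_rw [h3] at h1
  rw [integral_integral_swap] at h1
  · calc ∫ x, g x • (w x : ℂ) = ∫ x, (w x : ℂ) * G x := by
          congr with x
          rw [hGg, Complex.real_smul, mul_comm]
      _ = ∫ x, ∫ ξ, G x * planeWave ξ x ∂ν := h1.symm
      _ = _ := by
          congr with x
          rw [integral_const_mul, hGg, Complex.real_smul]
  · have := (G.integrable (μ := volume)).comp_snd ν
    refine (this.mul_bdd (c := 1) continuous_planeWave.aestronglyMeasurable
      (Eventually.of_forall fun p => (norm_planeWave _ _).le)).congr ?_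
    exact Eventually.of_forall fun p => rfl

theorem truncInteraction_converges_eucl {κ s : ℝ} (hκ : 0 < κ) (hs : -1 ≤ s) {v : Eucl d → ℝ}
    (hv : ∀ x, 0 ≤ v x) {lam : ℕ → ℝ} {u : HilbertBasis ℕ ℂ (L2 (Eucl d))}
    (hspec : IsSpectralDecomposition id κ v lam u) (htr : tracePow lam (s - 1) < ∞)
    {w : Eucl d → ℝ} (hw : MemLp w ∞ volume) (hpos : IsPositiveTypeEucl w) :
    IsCauchyInAllLp gaussianMeasure (truncInteraction lam u w) ∧
      ∃ W : (ℕ → ℂ) → ℝ, IsLimitInAllLp gaussianMeasure (truncInteraction lam u w) W ∧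
        ∀ W' : (ℕ → ℂ) → ℝ, IsLimitInAllLp gaussianMeasure (truncInteraction lam u w) W' →
          W' =ᵐ[gaussianMeasure] W := by
  obtain ⟨ν, hν⟩ := hpos
  have := isFiniteMeasure_of_fourier hw hν
  have hlam := hspec.le_eigenvalue hv
  refine truncInteraction_converges (ν := ν) (e := planeWave) continuous_planeWave.measurable
    norm_planeWave (fun k => hκ.trans_le (hlam k)) (summable_inv_sq_of_tracePow hκ hlam hs htr) ?_
  -- Null sets pull back to null sets under `(x, y) ↦ x - y`, so the identity for almost every point
  -- suffices.
  have h := (quasiMeasurePreserving_sub (volume : Measure (Eucl d)) volume).ae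
    (ae_eq_integral_planeWave hw hν)
  filter_upwards [h] with p hp
  rw [hp]
  simp_rw [planeWave_sub]

end Euclidean

/-! ### Absolutely convergent Fourier series on the torus. -/

section Torus

open UnitAddTorus

variable {d : ℕ}

/-- The Haar probability measure of the torus, as a product of Haar measures on circles. -/
noncomputable abbrev torusHaar (d : ℕ) : Measure (Torus d) :=
  Measure.pi fun _ => AddCircle.haarAddCircle

lemma volume_torus_eq (d : ℕ) : (volume : Measure (Torus d)) = torusHaar d := by
  rw [volume_pi]
  congr with i
  rw [AddCircle.volume_eq_smul_haarAddCircle]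
  simp

lemma integral_mFourier_torusHaar (n : Fin d → ℤ) :
    ∫ x, mFourier n x ∂(torusHaar d) = if n = 0 then 1 else 0 := by
  have h := (orthonormal_iff_ite.1 (orthonormal_mFourier (d := Fin d))) 0 n
  simp only [ContinuousMap.inner_toLp, ← mFourier_neg, ← mFourier_add] at h
  simp only [neg_zero, add_zero, eq_comm (a := (0 : Fin d → ℤ))] at h
  exact h

lemma mFourier_sub_apply (n : Fin d → ℤ) (x y : Torus d) :
    mFourier n (x - y) = mFourier n x * conj (mFourier n y) := by
  simp only [mFourier, ContinuousMap.coe_mk, map_prod, ← Finset.prod_mul_distrib, Pi.sub_apply]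
  refine Finset.prod_congr rfl fun i _ => ?_
  rw [fourier_apply, fourier_apply, fourier_apply, zsmul_sub, sub_eq_add_neg,
    AddCircle.toCircle_add, AddCircle.toCircle_neg, Circle.coe_mul, Circle.coe_inv_eq_conj]

lemma norm_mFourier_apply (n : Fin d → ℤ) (x : Torus d) : ‖mFourier n x‖ = 1 := by
  simp only [mFourier, fourier_apply, ContinuousMap.coe_mk, norm_prod]
  exact Finset.prod_eq_one fun i _ => Circle.norm_coe _

lemma sum_mFourier_mul_conj (S : Finset (Fin d → ℤ)) (x : Torus d) :
    ((‖∑ m ∈ S, mFourier m x‖ ^ 2 : ℝ) : ℂ) = ∑ m ∈ S, ∑ m' ∈ S, mFourier (-(m' - m)) x := by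
  rw [← Complex.normSq_eq_norm_sq, ← Complex.mul_conj, map_sum, Finset.sum_mul_sum]
  refine Finset.sum_congr rfl fun m _ => Finset.sum_congr rfl fun m' _ => ?_
  rw [← mFourier_neg, ← mFourier_add, neg_sub, sub_eq_add_neg]

lemma integral_sum_mFourier_mul {w : Torus d → ℂ} (hw : Integrable w (torusHaar d))
    (S : Finset (Fin d → ℤ)) :
    ∫ x, ((‖∑ m ∈ S, mFourier m x‖ ^ 2 : ℝ) : ℂ) * w x ∂(torusHaar d) =
      ∑ m ∈ S, ∑ m' ∈ S, ∫ x, mFourier (-(m' - m)) x * w x ∂(torusHaar d) := by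
  have hint : ∀ n : Fin d → ℤ, Integrable (fun x => mFourier n x * w x) (torusHaar d) := fun n =>
    hw.bdd_mul (c := 1) (mFourier n).continuous.aestronglyMeasurable
      (Eventually.of_forall fun x => (norm_mFourier_apply n x).le)
  simp_rw [sum_mFourier_mul_conj, Finset.sum_mul]
  rw [integral_finsetSum _ fun m _ => integrable_finsetSum _ fun m' _ => hint _]
  exact Finset.sum_congr rfl fun m _ => integral_finsetSum _ fun m' _ => hint _

/-- The cube `{-R, …, R}^d`. -/
noncomputable def intCube (d R : ℕ) : Finset (Fin d → ℤ) := Fintype.piFinset fun _ => Finset.Icc (-R : ℤ) R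

lemma mem_intCube {R : ℕ} {n : Fin d → ℤ} : n ∈ intCube d R ↔ ∀ i, |n i| ≤ R := by
  simp [intCube, abs_le]

lemma card_intCube (d R : ℕ) : (intCube d R).card = (2 * R + 1) ^ d := by
  simp only [intCube, Fintype.card_piFinset, Int.card_Icc, Finset.prod_const, Finset.card_univ,
    Fintype.card_fin]
  congr 1
  omega

/-- The Fourier coefficients of a bounded function are summable once they are nonnegative. -/
lemma summable_of_fourierCoeff_nonneg {w : Torus d → ℝ} {C : ℝ}
    (hwm : AEStronglyMeasurable w (torusHaar d)) (hwC : ∀ᵐ x ∂(torusHaar d), ‖w x‖ ≤ C)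
    {c : (Fin d → ℤ) → ℝ} (hc : ∀ n, 0 ≤ c n)
    (hcw : ∀ n, ∫ x, mFourier (-n) x * (w x : ℂ) ∂(torusHaar d) = c n) : Summable c := by
  have hw : Integrable (fun x => (w x : ℂ)) (torusHaar d) :=
    (Integrable.of_bound hwm C hwC).ofReal
  refine summable_of_sum_le (c := 2 ^ d * C) hc fun T => ?_
  obtain ⟨R, hR⟩ : ∃ R : ℕ, ∀ t ∈ T, t ∈ intCube d R := by
    refine ⟨∑ t ∈ T, ∑ i, (t i).natAbs, fun t ht => mem_intCube.2 fun i => ?_⟩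
    have h1 : (t i).natAbs ≤ ∑ i, (t i).natAbs :=
      Finset.single_le_sum (f := fun i => (t i).natAbs) (fun _ _ => Nat.zero_le _)
        (Finset.mem_univ i)
    have h2 : ∑ i, (t i).natAbs ≤ ∑ t ∈ T, ∑ i, (t i).natAbs :=
      Finset.single_le_sum (f := fun t : Fin d → ℤ => ∑ i, (t i).natAbs)
        (fun _ _ => Nat.zero_le _) ht
    rw [Int.abs_eq_natAbs]
    exact_mod_cast h1.trans h2
  -- The doubled cube contains `m + t` for all `m` in the cube of size `R` and `t ∈ T`, so each `c
  -- t` occurs at least `(intCube d R).card` times in the double sum.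
  set S := intCube d (2 * R)
  have hupper : ∑ m ∈ S, ∑ m' ∈ S, c (m' - m) ≤ C * S.card := by
    have h1 := integral_sum_mFourier_mul hw S
    -- The same identity with constant weight gives the total mass `S.card` of the nonnegative
    -- kernel.
    have h2 := integral_sum_mFourier_mul (w := fun _ => (1 : ℂ)) (integrable_const _) S
    simp_rw [hcw] at h1
    simp only [mul_one, integral_mFourier_torusHaar, neg_eq_zero, sub_eq_zero,
      Finset.sum_ite_eq', Finset.sum_ite_mem, Finset.inter_self, Finset.sum_const,
      nsmul_eq_mul, integral_complex_ofReal] at h2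
    have h2' : ∫ x, ‖∑ m ∈ S, mFourier m x‖ ^ 2 ∂(torusHaar d) = S.card := by exact_mod_cast h2
    have h1' : ∫ x, ‖∑ m ∈ S, mFourier m x‖ ^ 2 * w x ∂(torusHaar d) =
        ∑ m ∈ S, ∑ m' ∈ S, c (m' - m) := by
      apply Complex.ofReal_injective
      rw [← integral_complex_ofReal]
      push_cast at h1 ⊢
      exact h1
    have hDc : Continuous fun x : Torus d => ‖∑ m ∈ S, mFourier m x‖ ^ 2 := by fun_prop
    have hDint : Integrable (fun x : Torus d => ‖∑ m ∈ S, mFourier m x‖ ^ 2) (torusHaar d) := by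
      refine Integrable.of_bound hDc.aestronglyMeasurable ((S.card : ℝ) ^ 2)
        (Eventually.of_forall fun x => ?_)
      rw [norm_pow, norm_norm]
      gcongr
      refine (norm_sum_le _ _).trans (le_of_eq ?_)
      simp [norm_mFourier_apply]
    rw [← h1', ← h2', ← integral_const_mul]
    refine (Real.le_norm_self _).trans (norm_integral_le_of_norm_le (hDint.const_mul C) ?_)
    filter_upwards [hwC] with x hx
    rw [norm_mul, norm_pow, norm_norm, mul_comm]
    gcongr
  have hlower : (intCube d R).card * ∑ t ∈ T, c t ≤ ∑ m ∈ S, ∑ m' ∈ S, c (m' - m) := by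
    have hsub : intCube d R ⊆ S := fun n hn => mem_intCube.2 fun i =>
      (mem_intCube.1 hn i).trans (by push_cast; linarith [(Nat.cast_nonneg R : (0 : ℤ) ≤ R)])
    rw [← nsmul_eq_mul, ← Finset.sum_const]
    refine le_trans ?_ (Finset.sum_le_sum_of_subset_of_nonneg hsub fun m _ _ =>
      Finset.sum_nonneg fun m' _ => hc _)
    refine Finset.sum_le_sum fun m hm => ?_
    have : ∑ t ∈ T, c t = ∑ m' ∈ T.map (addRightEmbedding m), c (m' - m) := by
      simp [Finset.sum_map]
    rw [this]
    refine Finset.sum_le_sum_of_subset_of_nonneg (fun m' hm' => ?_) fun _ _ _ => hc _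
    obtain ⟨t, ht, rfl⟩ := Finset.mem_map.1 hm'
    refine mem_intCube.2 fun i => ?_
    have h1 := mem_intCube.1 (hR t ht) i
    have h2 := mem_intCube.1 hm i
    have h3 := abs_add_le (t i) (m i)
    simp only [addRightEmbedding_apply, Pi.add_apply]
    push_cast
    linarith
  have hC : 0 ≤ C := by
    obtain ⟨x, hx⟩ := hwC.exists
    exact (norm_nonneg _).trans hx
  -- `4R + 1 ≤ 2 (2R + 1)` in each coordinate, so the final bound does not depend on `R`.
  have hcard : (S.card : ℝ) ≤ 2 ^ d * (intCube d R).card := by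
    rw [card_intCube, card_intCube]
    push_cast
    rw [← mul_pow]
    gcongr
    linarith
  have hpos : (0 : ℝ) < (intCube d R).card := by
    rw [card_intCube]
    positivity
  refine le_of_mul_le_mul_left ?_ hpos
  calc _ ≤ C * S.card := hlower.trans hupper
    _ ≤ C * (2 ^ d * (intCube d R).card) := by gcongr
    _ = _ := by ring

/-- Summable coefficients make the series converge uniformly as well as in `L²`; by uniqueness of
the `L²` limit, its continuous sum represents `w`. -/
lemma ae_eq_tsum_mFourier {w : Torus d → ℝ} (hw : MemLp w ∞ (torusHaar d))
    {c : (Fin d → ℤ) → ℝ} (hsum : Summable c)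
    (hcw : ∀ n, ∫ x, mFourier (-n) x * (w x : ℂ) ∂(torusHaar d) = c n) :
    ∀ᵐ x ∂(torusHaar d), (w x : ℂ) = ∑' n, (c n : ℂ) * mFourier n x := by
  have hw2 : MemLp (fun x => (w x : ℂ)) 2 (torusHaar d) := hw.ofReal.mono_exponent le_top
  have hcoef : ∀ n, mFourierCoeff (hw2.toLp) n = c n := by
    intro n
    rw [← hcw n]
    refine integral_congr_ae ?_
    filter_upwards [hw2.coeFn_toLp] with x hx
    rw [hx, smul_eq_mul]
  have h1 := hasSum_mFourier_series_L2 hw2.toLp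
  simp_rw [hcoef] at h1
  have hS : Summable fun n => (c n : ℂ) • mFourier n := by
    refine Summable.of_norm ?_
    simp_rw [norm_smul, mFourier_norm, mul_one, Complex.norm_real]
    exact hsum.norm
  have h2 := hS.hasSum.mapL (ContinuousMap.toLp (E := ℂ) 2 (torusHaar d) ℂ)
  simp only [map_smul] at h2
  have h3 := h1.unique h2
  have h4 := ContinuousMap.coeFn_toLp (p := 2) (𝕜 := ℂ) (torusHaar d)
    (∑' n, (c n : ℂ) • mFourier n)
  rw [← h3] at h4
  filter_upwards [hw2.coeFn_toLp, h4] with x hx hx'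
  rw [← hx, hx']
  have h5 := hS.hasSum.mapL (ContinuousMap.evalCLM ℂ x)
  simp only [map_smul] at h5
  exact h5.tsum_eq.symm

theorem truncInteraction_converges_torus {κ s : ℝ} (hκ : 0 < κ) (hs : -1 ≤ s) {v : Torus d → ℝ}
    (hv : ∀ x, 0 ≤ v x) {lam : ℕ → ℝ} {u : HilbertBasis ℕ ℂ (L2 (Torus d))}
    (hspec : IsSpectralDecomposition (torusProj d) κ v lam u) (htr : tracePow lam (s - 1) < ∞)
    {w : Torus d → ℝ} (hw : MemLp w ∞ volume) (hpos : IsPositiveTypeTorus w) :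
    IsCauchyInAllLp gaussianMeasure (truncInteraction lam u w) ∧
      ∃ W : (ℕ → ℂ) → ℝ, IsLimitInAllLp gaussianMeasure (truncInteraction lam u w) W ∧
        ∀ W' : (ℕ → ℂ) → ℝ, IsLimitInAllLp gaussianMeasure (truncInteraction lam u w) W' →
          W' =ᵐ[gaussianMeasure] W := by
  have hlam := hspec.le_eigenvalue hv
  -- The order on `ℂ` forces a zero imaginary part, so taking real parts loses nothing.
  set c : (Fin d → ℤ) → ℝ := fun n => (∫ x, mFourier (-n) x * (w x : ℂ)).re with hcdef
  have hc : ∀ n, 0 ≤ c n := fun n => (Complex.nonneg_iff.1 (hpos n)).1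
  have hwT : MemLp w ∞ (torusHaar d) := by rwa [← volume_torus_eq]
  have hcw : ∀ n, ∫ x, mFourier (-n) x * (w x : ℂ) ∂(torusHaar d) = c n := by
    intro n
    rw [← volume_torus_eq]
    exact Complex.ext rfl (Complex.nonneg_iff.1 (hpos n)).2.symm
  have hwC : ∀ᵐ x ∂(torusHaar d), ‖w x‖ ≤ (eLpNorm w ∞ (torusHaar d)).toReal := by
    filter_upwards [enorm_ae_le_eLpNormEssSup w (torusHaar d)] with x hx
    rw [← eLpNorm_exponent_top] at hx
    have := ENNReal.toReal_mono hwT.2.ne hx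
    rwa [toReal_enorm] at this
  have hsum : Summable c := summable_of_fourierCoeff_nonneg hwT.1 hwC hc hcw
  -- The spectral measure has the Fourier coefficients as point masses; its finiteness is exactly
  -- their summability.
  set ν : Measure (Fin d → ℤ) := Measure.sum fun n => ENNReal.ofReal (c n) • Measure.dirac n
    with hν
  have : IsFiniteMeasure ν := by
    constructor
    rw [hν, Measure.sum_apply _ MeasurableSet.univ]
    simp only [Measure.smul_apply, measure_univ, smul_eq_mul, mul_one]
    rw [← ENNReal.ofReal_tsum_of_nonneg hc hsum]
    exact ENNReal.ofReal_lt_top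
  refine truncInteraction_converges (ν := ν) (e := fun n x => mFourier n x)
    (measurable_from_prod_countable_right fun n => (mFourier n).continuous.measurable)
    norm_mFourier_apply (fun k => hκ.trans_le (hlam k))
    (summable_inv_sq_of_tracePow hκ hlam hs htr) ?_
  have h0 := ae_eq_tsum_mFourier hwT hsum hcw
  rw [← volume_torus_eq] at h0
  have h := (quasiMeasurePreserving_sub (volume : Measure (Torus d)) volume).ae h0
  filter_upwards [h] with p hp
  rw [hp, integral_countable]
  · refine tsum_congr fun n => ?_
    rw [Measure.real, hν, Measure.sum_smul_dirac_singleton, ENNReal.toReal_ofReal (hc n),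
      mFourier_sub_apply, Complex.real_smul]
  · refine Integrable.of_bound (C := 1) (Measurable.of_discrete).aestronglyMeasurable
      (Eventually.of_forall fun n => ?_)
    simp [norm_mFourier_apply]

end Torus

end WickInteraction

theorem lemma1p2 (d : ℕ) (hd : 1 ≤ d ∧ d ≤ 3) (κ : ℝ) (hκ : 0 < κ) (s : ℝ) (hs : -1 ≤ s) :
    -- the case `Λ = ℝ^d`
    (∀ (v : Eucl d → ℝ), Measurable v → (∀ x, 0 ≤ v x) →
      ∀ (lam : ℕ → ℝ) (u : HilbertBasis ℕ ℂ (L2 (Eucl d))),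
      IsSpectralDecomposition id κ v lam u →
      tracePow lam (s - 1) < ∞ →
      ∀ w : Eucl d → ℝ, MemLp w ∞ volume → (∀ᵐ x, w (-x) = w x) →
      IsPositiveTypeEucl w →
        IsCauchyInAllLp gaussianMeasure
          (truncInteraction lam u w) ∧
        ∃ W : (ℕ → ℂ) → ℝ,
          IsLimitInAllLp gaussianMeasure
            (truncInteraction lam u w) W ∧
          ∀ W' : (ℕ → ℂ) → ℝ,
            IsLimitInAllLp gaussianMeasure
              (truncInteraction lam u w) W' →
            W' =ᵐ[gaussianMeasure] W) ∧
    -- the case `Λ = ℝ^d / ℤ^d`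
    (∀ (v : Torus d → ℝ), Measurable v → (∀ x, 0 ≤ v x) →
      ∀ (lam : ℕ → ℝ) (u : HilbertBasis ℕ ℂ (L2 (Torus d))),
      IsSpectralDecomposition (torusProj d) κ v lam u →
      tracePow lam (s - 1) < ∞ →
      ∀ w : Torus d → ℝ, MemLp w ∞ volume → (∀ᵐ x, w (-x) = w x) →
      IsPositiveTypeTorus w →
        IsCauchyInAllLp gaussianMeasure
          (truncInteraction lam u w) ∧
        ∃ W : (ℕ → ℂ) → ℝ,
          IsLimitInAllLp gaussianMeasure
            (truncInteraction lam u w) W ∧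
          ∀ W' : (ℕ → ℂ) → ℝ,
            IsLimitInAllLp gaussianMeasure
              (truncInteraction lam u w) W' →
            W' =ᵐ[gaussianMeasure] W) := by
  refine ⟨fun v _ hv lam u hspec htr w hw _ hpos => ?_, fun v _ hv lam u hspec htr w hw _ hpos => ?_⟩
  · exact truncInteraction_converges_eucl hκ hs hv hspec htr hw hpos
  · exact truncInteraction_converges_torus hκ hs hv hspec htr hw hpos
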